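/- Setting. Let $\mathcal X\subset\mathbb R^d$ be convex and compact, let $q\in(0,1)$, and let $\beta\in\mathbb R^d$ be a fixed unit vector. An agent has a type $(Z,c)$, consisting of raw covariates $Z\in\mathcal X$ and a cost function $c:\mathbb R^d\to\mathbb R$, and an independent noise vector $\epsilon\sim N(0,\sigma^2 I_d)$. Given a threshold $s\in\mathbb R$, the best response of an agent of type $(Z,c)$ is $$x^*(\beta,s)=\operatorname*{arg\,max}_{x\in\mathcal X}\ \mathbb E_\epsilon\big[-c(x-Z)+\mathbf 1\{\beta^T(x+\epsilon)>s\}\big],$$ and the score of the agent is $\beta^T(x^*(\beta,s)+\epsilon)$. Let $P(\beta,s)(\cdot)$ be the CDF of the score of a randomly drawn agent, and let $q(G)=\inf\{r: G(r)\ge q\}$ denote the $q$-th quantile of a CDF $G$. Assumptions. (i) The law of $(Z,c)$ has finite support. (ii) For each type in the support, $c$ is twice continuously differentiable, $\alpha_{(Z,c)}$-strongly convex with $\alpha_{(Z,c)}>0$, and minimized at the origin; $\alpha_*$ denotes the infimum of $\alpha_{(Z,c)}$ over the support. (iii) For each type in the support and each $s\in\mathbb R$, $x^*(\beta,s)\in\operatorname{Int}(\mathcal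 X)$. (iv) $\sigma^2>\frac{2}{\alpha_*\sqrt{2\pi e}}$. Stochastic fixed-point iteration. Starting from $\hat S_n^0\in\mathbb R$, in each step $t=1,2,\dots$ a fresh sample of $n$ i.i.d. agents (independent of all earlier samples) responds to the threshold $\hat S_n^{t-1}$, and $\hat S_n^t$ is the $q$-th quantile of the empirical CDF of their $n$ scores. Theorem. Under (i)--(iv), the map $s\mapsto q(P(\beta,s))$ has a unique fixed point $s(\beta)$, and its (smallest) Lipschitz constant $\kappa$ satisfies $0<\kappa<1$. Let $\lambda,\delta\in(0,1)$, put $\lambda_g=\frac{\lambda(1-\kappa)}{2}$ and $$M_{\lambda_g}=\inf_{s\in\mathbb R}\min\big\{P(\beta,s)\big(q(P(\beta,s))+\lambda_g\big)-q,\ q-P(\beta,s)\big(q(P(\beta,s))-\lambda_g\big)\big\},$$ and $C=|\hat S_n^0-s(\beta)|$. Then $M_{\lambda_g}>0$, and for all $n,t$ with $$t\ \ge\ \Big\lceil\frac{\log(\lambda/(2C))}{\log\kappa}\Big\rceil\qquad\text{and}\qquad n\ \ge\ \frac{1}{2M_{\lambda_g}^2}\log\frac{4t}{\delta}$$ we have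 $$P\big(|\hat S_n^t-s(\beta)|\ge\lambda\big)\le\delta.$$ (For $C=0$ the condition on $t$, and for $t=0$ the condition on $n$, is void.) -/

import Mathlib

open MeasureTheory ProbabilityTheory

noncomputable section

namespace StrategicThreshold

/-- The covariate space `ℝ^d` with its Euclidean norm. -/
abbrev Cov (d : ℕ) : Type := EuclideanSpace ℝ (Fin d)

/-- The type `(Z, c)` of an agent: raw covariates `Z` and a cost function `c`. -/
structure AgentType (d : ℕ) where
  /-- The raw covariates `Z`. -/
  raw : Cov d
  /-- The cost `c` of deviating from the raw covariates. -/
  cost : Cov d → ℝ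

/-- Agent types are only given laws of finite support, so they carry the discrete `σ`-algebra. -/
instance instMeasurableSpaceAgentType (d : ℕ) : MeasurableSpace (AgentType d) := ⊤

/-- The unobservables `((Z, c), ε)` of an agent. -/
abbrev Agent (d : ℕ) : Type := AgentType d × Cov d

/-- A cost function that is twice continuously differentiable, `a`-strongly convex with `a > 0`,
and minimized at the origin. -/
def AdmissibleCost {d : ℕ} (c : Cov d → ℝ) (a : ℝ) : Prop :=
  ContDiff ℝ 2 c ∧ 0 < a ∧ StrongConvexOn Set.univ a c ∧ ∀ y, c 0 ≤ c y

/-- The noise law `N(0, σ² I_d)`. -/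
def noiseLaw (d : ℕ) (σ : ℝ) : Measure (Cov d) :=
  multivariateGaussian 0 (σ ^ 2 • (1 : Matrix (Fin d) (Fin d) ℝ))

/-- The joint law of an agent's unobservables `((Z, c), ε)`: the noise is independent of the
type. -/
def agentLaw {d : ℕ} (F : PMF (AgentType d)) (σ : ℝ) : Measure (Agent d) :=
  F.toMeasure.prod (noiseLaw d σ)

/-- The threshold rule `π(x; β, s) = 1{βᵀx > s}`. -/
def treat {d : ℕ} (β : Cov d) (s : ℝ) (x : Cov d) : ℝ :=
  if s < inner ℝ β x then 1 else 0

/-- The expected utility `E_ε[-c(x - Z) + π(x + ε; β, s)]` of an agent of type `θ = (Z, c)`. -/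
def expectedUtility {d : ℕ} (σ : ℝ) (β : Cov d) (s : ℝ) (θ : AgentType d) (x : Cov d) : ℝ :=
  ∫ ε, (-θ.cost (x - θ.raw) + treat β s (x + ε)) ∂(noiseLaw d σ)

/-- `x` is a maximizer over `X` of the expected utility. -/
def IsBestResponse {d : ℕ} (X : Set (Cov d)) (σ : ℝ) (β : Cov d) (s : ℝ) (θ : AgentType d)
    (x : Cov d) : Prop :=
  x ∈ X ∧ ∀ y ∈ X, expectedUtility σ β s θ y ≤ expectedUtility σ β s θ x

open Classical in
/-- The best response `x*(β, s) = argmax_{x ∈ X} E_ε[U(x; β, s)]` (with the value `0` if there is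
no maximizer). -/
def bestResponse {d : ℕ} (X : Set (Cov d)) (σ : ℝ) (β : Cov d) (s : ℝ) (θ : AgentType d) :
    Cov d :=
  if h : ∃ x, IsBestResponse X σ β s θ x then h.choose else 0

/-- The score `βᵀ(x*(β, s) + ε)` of the covariates that an agent reports. -/
def score {d : ℕ} (X : Set (Cov d)) (σ : ℝ) (β : Cov d) (s : ℝ) (a : Agent d) : ℝ :=
  inner ℝ β (bestResponse X σ β s a.1 + a.2)

/-- The CDF `P(β, s)` of the score of a random agent. -/
def scoreCDF {d : ℕ} (X : Set (Cov d)) (F : PMF (AgentType d)) (σ : ℝ) (β : Cov d) (s : ℝ) :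
    ℝ → ℝ :=
  cdf ((agentLaw F σ).map (score X σ β s))

/-- The `q`-th quantile `inf {r | G(r) ≥ q}` of a CDF `G`. -/
def quantile (q : ℝ) (G : ℝ → ℝ) : ℝ := sInf {r | q ≤ G r}

/-- The mean-field operator `s ↦ q(P(β, s))`. -/
def meanFieldOp {d : ℕ} (X : Set (Cov d)) (F : PMF (AgentType d)) (σ q : ℝ) (β : Cov d)
    (s : ℝ) : ℝ :=
  quantile q (scoreCDF X F σ β s)

/-- The (smallest) Lipschitz constant of a function on the line. -/
def lipschitzConst (f : ℝ → ℝ) : ℝ :=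
  sInf {K : ℝ | 0 ≤ K ∧ ∀ x y, |f x - f y| ≤ K * |x - y|}

/-- The uniform quantile gap
`M_l = inf_s min {P(β, s)(q(P(β, s)) + l) - q, q - P(β, s)(q(P(β, s)) - l)}`. -/
def quantileGap {d : ℕ} (X : Set (Cov d)) (F : PMF (AgentType d)) (σ q : ℝ) (β : Cov d)
    (l : ℝ) : ℝ :=
  ⨅ s : ℝ, min (scoreCDF X F σ β s (meanFieldOp X F σ q β s + l) - q)
    (q - scoreCDF X F σ β s (meanFieldOp X F σ q β s - l))

/-- `α_*`, the infimum of the strong convexity parameters over the types in the support. -/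
def alphaStar {d : ℕ} (F : PMF (AgentType d)) (α : AgentType d → ℝ) : ℝ :=
  ⨅ θ : F.support, α θ

/-- The empirical CDF of a sample of size `n`. -/
def empiricalCDF {n : ℕ} (x : Fin n → ℝ) (r : ℝ) : ℝ :=
  ((Finset.univ.filter fun i => x i ≤ r).card : ℝ) / n

/-- The threshold `Ŝ_n^t` of the stochastic fixed-point iteration started at `s₀`, along one
realization of the agents: `agents t` are the `n` agents who arrive in step `t + 1` and respond to
the threshold `Ŝ_n^t`. -/
def empThreshold {d n : ℕ} (X : Set (Cov d)) (σ q : ℝ) (β : Cov d) (s₀ : ℝ)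
    (agents : ℕ → Fin n → Agent d) : ℕ → ℝ
  | 0 => s₀
  | t + 1 => quantile q (empiricalCDF fun i =>
      score X σ β (empThreshold X σ q β s₀ agents t) (agents t i))

end StrategicThreshold

end

/-!
The score of an agent of type `θ` is `g_θ(s) + βᵀε`, where `g_θ(s) = βᵀx*_θ(s)` and `βᵀε` has law
`N(0, σ²)`. So the score distribution `P(β, s)` is a finite location mixture of normal
distributions.

*Contraction.* A best response `x` satisfies, for all `y ∈ X`,
`c(y - Z) - c(x - Z) ≥ (α/2)|y - x|² + φ(s - βᵀx) βᵀ(y - x)` with `φ` the noise density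
(`IsBestResponse.le_cost_sub`). Adding this inequality at two thresholds, each with the other
response as competitor, gives `α|Δg|² ≤ H(|Δs| + |Δg|)|Δg|`, where `H = 1 / (σ²√(2πe))` bounds the
slope of `φ`. The noise condition says `H < α_*/2`, so that `g_θ` is Lipschitz with constant
`H / (α_* - H) < 1` (`Assumptions.exists_contraction`). A quantile of a location mixture moves no
further than the locations do, so the mean-field operator has the same constant
(`Assumptions.exists_meanFieldOp_lipschitz`), and Banach's theorem gives the equilibrium. The
operator is not constant, hence `κ > 0`: `g_θ(s) > βᵀZ` at every threshold, because an interior best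
response games strictly, but `g_θ(s) → βᵀZ` as `s → ∞` (`Assumptions.meanFieldOp_not_const`).

*Quantile gap.* Locations and quantiles are bounded uniformly in `s`, and by compactness the normal
distribution function increases by a definite amount over intervals of length `l` in a bounded set
(`Assumptions.quantileGap_pos_and_le`).

*Concentration.* For a fixed threshold, Hoeffding's inequality at the two points `q(P(β, s)) ± l`
shows that the empirical quantile is within `l` of `q(P(β, s))` with probability at least
`1 - 2 exp(-2nM²)`. The current threshold depends only on earlier agents, so by independence and
Fubini the same bound holds for each step of the iteration (`measure_thresholdSeq_succ_le`). On the
complement of a union of `t` bad events, the iteration is a perturbed contraction, whose error is at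
most `κ^t C + l (1 - κ^t) / (1 - κ)` (`abs_sub_fixedPoint_le`). With `l = λ(1 - κ)/2` and
`κ^t C ≤ λ/2` this is less than `λ`.
-/

noncomputable section

namespace StrategicThreshold

open Filter Topology
open scoped NNReal ENNReal

/-! ### The normal distribution -/

lemma gaussian_cdf_sub_eq_integral {v : ℝ≥0} (hv : v ≠ 0) (a b : ℝ) :
    cdf (gaussianReal 0 v) b - cdf (gaussianReal 0 v) a
      = ∫ x in a..b, gaussianPDFReal 0 v x := by
  have h (x : ℝ) : cdf (gaussianReal 0 v) x = ∫ y in Set.Iic x, gaussianPDFReal 0 v y := by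
    rw [cdf_eq_real, measureReal_def, gaussianReal_apply_eq_integral 0 hv,
      ENNReal.toReal_ofReal (integral_nonneg fun y => gaussianPDFReal_nonneg 0 v y)]
  rw [h, h, intervalIntegral.integral_Iic_sub_Iic]
  · exact (integrable_gaussianPDFReal 0 v).integrableOn
  · exact (integrable_gaussianPDFReal 0 v).integrableOn

lemma continuous_gaussianPDFReal (v : ℝ≥0) : Continuous (gaussianPDFReal 0 v) := by
  unfold gaussianPDFReal
  fun_prop

lemma hasDerivAt_gaussian_cdf {v : ℝ≥0} (hv : v ≠ 0) (x : ℝ) :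
    HasDerivAt (cdf (gaussianReal 0 v)) (gaussianPDFReal 0 v x) x := by
  have h : (cdf (gaussianReal 0 v) : ℝ → ℝ) = fun y =>
      cdf (gaussianReal 0 v) 0 + ∫ z in (0 : ℝ)..y, gaussianPDFReal 0 v z := by
    funext y
    rw [← gaussian_cdf_sub_eq_integral hv]
    ring
  rw [h]
  exact ((continuous_gaussianPDFReal v).integral_hasStrictDerivAt 0 x).hasDerivAt.const_add _

lemma continuous_gaussian_cdf {v : ℝ≥0} (hv : v ≠ 0) : Continuous (cdf (gaussianReal 0 v)) :=
  continuous_iff_continuousAt.2 fun x => (hasDerivAt_gaussian_cdf hv x).continuousAt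

lemma strictMono_gaussian_cdf {v : ℝ≥0} (hv : v ≠ 0) : StrictMono (cdf (gaussianReal 0 v)) :=
  strictMono_of_hasDerivAt_pos (fun x => hasDerivAt_gaussian_cdf hv x)
    fun x => gaussianPDFReal_pos 0 v x hv

/-- The sharp bound `1 / (v √(2πe))` for the slope of the density of `N(0, v)`, attained at `±√v`.
It comes from `u e^{-u²/2} ≤ e^{-1/2}`, that is from `u² ≤ e^{u² - 1}`. -/
def pdfSlope (v : ℝ) : ℝ := 1 / (v * √(2 * Real.pi * Real.exp 1))

lemma pdfSlope_nonneg {v : ℝ} (hv : 0 ≤ v) : 0 ≤ pdfSlope v := by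
  unfold pdfSlope; positivity

lemma hasDerivAt_gaussianPDFReal (v : ℝ≥0) (x : ℝ) :
    HasDerivAt (gaussianPDFReal 0 v) (-(x / v) * gaussianPDFReal 0 v x) x := by
  have h1 : HasDerivAt (fun x : ℝ => -(x - 0) ^ 2 / (2 * (v : ℝ))) (-(x / v)) x := by
    have := ((((hasDerivAt_id x).sub_const 0).pow 2).neg.div_const (2 * (v : ℝ)))
    refine HasDerivAt.congr_deriv (f := fun x : ℝ => -(x - 0) ^ 2 / (2 * (v : ℝ))) this ?_
    simp only [id]
    by_cases hv : (v : ℝ) = 0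
    · simp [hv]
    · simp; field_simp
  have := (h1.exp.const_mul ((√(2 * Real.pi * v))⁻¹))
  unfold gaussianPDFReal
  refine HasDerivAt.congr_deriv this ?_
  ring

lemma abs_mul_gaussianPDFReal_le {v : ℝ≥0} (hv : v ≠ 0) (x : ℝ) :
    |-(x / v) * gaussianPDFReal 0 v x| ≤ pdfSlope v := by
  have hv' : (0 : ℝ) < v := by positivity
  rw [abs_mul, abs_of_pos (gaussianPDFReal_pos 0 v x hv), abs_neg, abs_div, abs_of_pos hv']
  apply le_of_sq_le_sq _ (pdfSlope_nonneg hv'.le)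
  have hexp : x ^ 2 / v ≤ Real.exp (x ^ 2 / v - 1) := by
    have := Real.add_one_le_exp (x ^ 2 / (v : ℝ) - 1)
    linarith
  have e1 : (|x| / (v : ℝ) * gaussianPDFReal 0 v x) ^ 2
      = (x ^ 2 / v * Real.exp (-(x ^ 2 / v))) / (v ^ 2 * (2 * Real.pi)) := by
    unfold gaussianPDFReal
    rw [mul_pow, div_pow, sq_abs, mul_pow, inv_pow, Real.sq_sqrt (by positivity),
      ← Real.exp_nat_mul]
    have : ((2 : ℕ) : ℝ) * (-(x - 0) ^ 2 / (2 * v)) = -(x ^ 2 / v) := by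
      field_simp; norm_num; ring
    rw [this]
    field_simp
  have e2 : pdfSlope v ^ 2 = Real.exp (-1) / (v ^ 2 * (2 * Real.pi)) := by
    unfold pdfSlope
    rw [div_pow, mul_pow, Real.sq_sqrt (by positivity), Real.exp_neg]
    field_simp
  rw [e1, e2]
  gcongr
  calc x ^ 2 / v * Real.exp (-(x ^ 2 / v))
      ≤ Real.exp (x ^ 2 / v - 1) * Real.exp (-(x ^ 2 / v)) := by gcongr
    _ = Real.exp (-1) := by rw [← Real.exp_add]; ring_nf

lemma abs_gaussianPDFReal_sub_le {v : ℝ≥0} (hv : v ≠ 0) (x y : ℝ) :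
    |gaussianPDFReal 0 v x - gaussianPDFReal 0 v y| ≤ pdfSlope v * |x - y| := by
  have := Convex.norm_image_sub_le_of_norm_hasDerivWithin_le (s := Set.univ)
    (fun z _ => (hasDerivAt_gaussianPDFReal v z).hasDerivWithinAt)
    (fun z _ => abs_mul_gaussianPDFReal_le hv z) convex_univ (Set.mem_univ y) (Set.mem_univ x)
  simpa using this

lemma tendsto_gaussianPDFReal_atTop {v : ℝ≥0} (hv : v ≠ 0) :
    Tendsto (gaussianPDFReal 0 v) atTop (𝓝 0) := by
  have hv' : (0 : ℝ) < v := by positivity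
  have h : Tendsto (fun x : ℝ => -(x - 0) ^ 2 / (2 * (v : ℝ))) atTop atBot := by
    simp only [sub_zero]
    apply Tendsto.atBot_div_const (by positivity)
    exact tendsto_neg_atTop_atBot.comp (tendsto_pow_atTop two_ne_zero)
  have := (Real.tendsto_exp_atBot.comp h).const_mul ((√(2 * Real.pi * v))⁻¹)
  rw [mul_zero] at this
  exact this

/-- The noise in the score, `βᵀε` with `‖β‖ = 1`, is `N(0, σ²)`. -/
lemma noiseLaw_map_inner {d : ℕ} (σ : ℝ) {β : Cov d} (hβ : ‖β‖ = 1) :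
    (noiseLaw d σ).map (fun ε => inner ℝ β ε) = gaussianReal 0 (σ ^ 2).toNNReal := by
  have hS : (σ ^ 2 • (1 : Matrix (Fin d) (Fin d) ℝ)).PosSemidef :=
    Matrix.PosSemidef.one.smul (sq_nonneg σ)
  unfold noiseLaw
  have h := IsGaussian.map_eq_gaussianReal
    (μ := multivariateGaussian 0 (σ ^ 2 • (1 : Matrix (Fin d) (Fin d) ℝ))) (innerSL ℝ β)
  have hmean : ∫ x, innerSL ℝ β x ∂(multivariateGaussian 0
      (σ ^ 2 • (1 : Matrix (Fin d) (Fin d) ℝ))) = 0 := by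
    have := (innerSL ℝ β).integral_comp_id_comm (μ := multivariateGaussian 0
      (σ ^ 2 • (1 : Matrix (Fin d) (Fin d) ℝ))) IsGaussian.integrable_id
    rw [this, integral_id_multivariateGaussian, map_zero]
  rw [hmean] at h
  have hvar : Var[innerSL ℝ β; multivariateGaussian 0 (σ ^ 2 • (1 : Matrix (Fin d) (Fin d) ℝ))]
      = σ ^ 2 := by
    have h1 := covarianceBilin_self (μ := multivariateGaussian 0
      (σ ^ 2 • (1 : Matrix (Fin d) (Fin d) ℝ))) IsGaussian.memLp_two_id β
    rw [covarianceBilin_multivariateGaussian hS] at h1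
    rw [show (⇑(innerSL ℝ β) : Cov d → ℝ) = fun u => inner ℝ β u from rfl, ← h1]
    have h2 : β.ofLp ⬝ᵥ β.ofLp = 1 := by
      have := EuclideanSpace.real_norm_sq_eq β
      rw [hβ] at this
      simp only [dotProduct, ← sq]
      linarith
    rw [Matrix.smul_mulVec, Matrix.one_mulVec, dotProduct_smul, h2]
    simp
  rw [hvar] at h
  exact h

/-! ### Quantiles of location mixtures -/

lemma quantile_eq_of_strictMono {q r : ℝ} {G : ℝ → ℝ} (hG : StrictMono G) (hr : G r = q) :
    quantile q G = r := by
  have : {x | q ≤ G x} = Set.Ici r := by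
    ext x
    simp [← hr, hG.le_iff_le]
  rw [quantile, this, csInf_Ici]

/-- The location mixture `r ↦ ∑ wᵢ Φ(r - gᵢ)` of a distribution function `Φ`. -/
def mixture {ι : Type*} (T : Finset ι) (w : ι → ℝ) (Φ : ℝ → ℝ) (g : ι → ℝ) (r : ℝ) : ℝ :=
  ∑ i ∈ T, w i * Φ (r - g i)

section Mixture

variable {ι : Type*} {T : Finset ι} {w : ι → ℝ} {Φ : ℝ → ℝ} {q : ℝ}

lemma mixture_mono_of_le (hw : ∀ i ∈ T, 0 < w i) (hΦ : Monotone Φ) {g g' : ι → ℝ} {r r' : ℝ}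
    (h : ∀ i ∈ T, r - g i ≤ r' - g' i) : mixture T w Φ g r ≤ mixture T w Φ g' r' :=
  Finset.sum_le_sum fun i hi => mul_le_mul_of_nonneg_left (hΦ (h i hi)) (hw i hi).le

lemma mixture_lt_of_lt (hT : T.Nonempty) (hw : ∀ i ∈ T, 0 < w i) (hΦ : StrictMono Φ)
    {g g' : ι → ℝ} {r r' : ℝ} (h : ∀ i ∈ T, r - g i < r' - g' i) :
    mixture T w Φ g r < mixture T w Φ g' r' :=
  Finset.sum_lt_sum_of_nonempty hT fun i hi => mul_lt_mul_of_pos_left (hΦ (h i hi)) (hw i hi)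

lemma mixture_strictMono (hT : T.Nonempty) (hw : ∀ i ∈ T, 0 < w i) (hΦ : StrictMono Φ)
    (g : ι → ℝ) : StrictMono (mixture T w Φ g) := fun _ _ hr =>
  mixture_lt_of_lt hT hw hΦ fun i _ => sub_lt_sub_right hr (g i)

lemma continuous_mixture (hΦ : Continuous Φ) (g : ι → ℝ) : Continuous (mixture T w Φ g) := by
  unfold mixture
  fun_prop

/-- A mixture whose shifts are bounded by `B` takes the value `q` within distance `B` of the
`q`-quantile of `Φ`. -/
lemma exists_mixture_eq (hw : ∀ i ∈ T, 0 < w i) (hw1 : ∑ i ∈ T, w i = 1) (hΦ : Monotone Φ)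
    (hc : Continuous Φ) {u : ℝ} (hu : Φ u = q) {B : ℝ} (hB : 0 ≤ B) {g : ι → ℝ}
    (hg : ∀ i ∈ T, |g i| ≤ B) : ∃ r ∈ Set.Icc (u - B) (u + B), mixture T w Φ g r = q := by
  have hq : mixture T w Φ (fun _ => 0) u = q := by
    simp [mixture, hu, ← Finset.sum_mul, hw1]
  have h1 : mixture T w Φ g (u - B) ≤ q := by
    rw [← hq]
    refine mixture_mono_of_le hw hΦ fun i hi => ?_
    linarith [(abs_le.1 (hg i hi)).1]
  have h2 : q ≤ mixture T w Φ g (u + B) := by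
    rw [← hq]
    refine mixture_mono_of_le hw hΦ fun i hi => ?_
    linarith [(abs_le.1 (hg i hi)).2]
  exact intermediate_value_Icc (by linarith) (continuous_mixture hc g).continuousOn ⟨h1, h2⟩

/-- Shifting every component by at most `e` moves the quantile of the mixture by at most `e`. -/
lemma le_add_of_mixture_eq (hT : T.Nonempty) (hw : ∀ i ∈ T, 0 < w i) (hΦ : StrictMono Φ)
    {g g' : ι → ℝ} {r r' e : ℝ} (hr : mixture T w Φ g r = q) (hr' : mixture T w Φ g' r' = q)
    (h : ∀ i ∈ T, g i ≤ g' i + e) : r ≤ r' + e := by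
  rw [← (mixture_strictMono hT hw hΦ g).le_iff_le, hr, ← hr']
  exact mixture_mono_of_le hw hΦ.monotone fun i hi => by linarith [h i hi]

/-- By compactness, a continuous strictly increasing function increases by a definite amount over
intervals of length `l` that start in a bounded set. -/
lemma exists_pos_le_increment (hΦ : StrictMono Φ) (hc : Continuous Φ) {l : ℝ} (hl : 0 < l)
    (R : ℝ) : ∃ η > 0, ∀ u ∈ Set.Icc (-R) R, η ≤ Φ (u + l) - Φ u := by
  rcases (Set.Icc (-R) R).eq_empty_or_nonempty with h | h
  · exact ⟨1, one_pos, by simp [h]⟩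
  · obtain ⟨u₀, -, hu₀⟩ := isCompact_Icc.exists_isMinOn h
      (f := fun u => Φ (u + l) - Φ u) (by fun_prop)
    exact ⟨Φ (u₀ + l) - Φ u₀, sub_pos.2 (hΦ (by linarith)), fun u hu => hu₀ hu⟩

lemma le_mixture_add_sub (hw : ∀ i ∈ T, 0 < w i) (hw1 : ∑ i ∈ T, w i = 1) {η l r : ℝ}
    {g : ι → ℝ} (h : ∀ i ∈ T, η ≤ Φ (r - g i + l) - Φ (r - g i)) :
    η ≤ mixture T w Φ g (r + l) - mixture T w Φ g r := by
  calc η = ∑ i ∈ T, w i * η := by rw [← Finset.sum_mul, hw1, one_mul]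
    _ ≤ ∑ i ∈ T, w i * (Φ (r - g i + l) - Φ (r - g i)) :=
        Finset.sum_le_sum fun i hi => mul_le_mul_of_nonneg_left (h i hi) (hw i hi).le
    _ = _ := by
        unfold mixture
        rw [← Finset.sum_sub_distrib]
        refine Finset.sum_congr rfl fun i _ => ?_
        rw [show r + l - g i = r - g i + l by ring]
        ring

end Mixture

/-! ### Best responses -/

/-- The component `βᵀx*(β, s)` of the best response of type `θ` that enters the score. -/
def responseScore {d : ℕ} (X : Set (Cov d)) (σ : ℝ) (β : Cov d) (θ : AgentType d) (s : ℝ) : ℝ :=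
  inner ℝ β (bestResponse X σ β s θ)

instance {d : ℕ} (σ : ℝ) : IsProbabilityMeasure (noiseLaw d σ) := by
  unfold noiseLaw; infer_instance

section BestResponse

variable {d : ℕ} {X : Set (Cov d)} {σ : ℝ} {β : Cov d} {θ : AgentType d} {a s : ℝ}

lemma noiseLaw_real_inner_le (hβ : ‖β‖ = 1) (r : ℝ) :
    (noiseLaw d σ).real {ε | inner ℝ β ε ≤ r} = cdf (gaussianReal 0 (σ ^ 2).toNNReal) r := by
  rw [cdf_eq_real, ← noiseLaw_map_inner (d := d) σ hβ,
    map_measureReal_apply (by fun_prop) measurableSet_Iic]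
  rfl

lemma expectedUtility_eq (hβ : ‖β‖ = 1) (x : Cov d) :
    expectedUtility σ β s θ x = -θ.cost (x - θ.raw)
      + (1 - cdf (gaussianReal 0 (σ ^ 2).toNNReal) (s - inner ℝ β x)) := by
  have hmeas : MeasurableSet {ε : Cov d | inner ℝ β ε ≤ s - inner ℝ β x} :=
    measurableSet_le (by fun_prop) (by fun_prop)
  have h : (fun ε => treat β s (x + ε)) =
      Set.indicator {ε : Cov d | inner ℝ β ε ≤ s - inner ℝ β x}ᶜ 1 := by
    funext ε
    simp only [treat, Set.indicator, Set.mem_compl_iff, Set.mem_ofPred_eq, inner_add_right, not_le,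
      sub_lt_iff_lt_add', Pi.one_apply]
  unfold expectedUtility
  rw [integral_add (integrable_const _) (by
    rw [h]; exact (integrable_const (1 : ℝ)).indicator hmeas.compl), h,
    integral_indicator_one hmeas.compl, probReal_compl_eq_one_sub hmeas,
    noiseLaw_real_inner_le hβ]
  simp

lemma isBestResponse_bestResponse (hX : IsCompact X) (hraw : θ.raw ∈ X) (hσ : σ ^ 2 ≠ 0)
    (hβ : ‖β‖ = 1) (hc : AdmissibleCost θ.cost a) :
    IsBestResponse X σ β s θ (bestResponse X σ β s θ) := by
  have hv : (σ ^ 2).toNNReal ≠ 0 := by simpa using hσ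
  have hcont : Continuous (expectedUtility σ β s θ) := by
    have h1 := hc.1.continuous
    have h2 := continuous_gaussian_cdf hv
    rw [show expectedUtility σ β s θ = _ from funext fun x => expectedUtility_eq hβ x]
    fun_prop
  obtain ⟨x, hx, hmax⟩ := hX.exists_isMaxOn ⟨_, hraw⟩ hcont.continuousOn
  have hex : ∃ x, IsBestResponse X σ β s θ x := ⟨x, hx, fun y hy => hmax hy⟩
  rw [bestResponse, dif_pos hex]
  exact hex.choose_spec

/-- The variational inequality for a maximizer `x` of the expected utility over a convex set. It
combines first-order optimality with strong convexity of the cost, and compares the utility at `x`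
with that at `x + t (y - x)` as `t → 0`. -/
lemma IsBestResponse.le_cost_sub (hX : Convex ℝ X) (hσ : σ ^ 2 ≠ 0)
    (hβ : ‖β‖ = 1) (hc : AdmissibleCost θ.cost a) {x y : Cov d}
    (hx : IsBestResponse X σ β s θ x) (hy : y ∈ X) :
    a / 2 * ‖y - x‖ ^ 2
      + gaussianPDFReal 0 (σ ^ 2).toNNReal (s - inner ℝ β x) * inner ℝ β (y - x)
      ≤ θ.cost (y - θ.raw) - θ.cost (x - θ.raw) := by
  have hv : (σ ^ 2).toNNReal ≠ 0 := by simpa using hσ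
  set Φ : ℝ → ℝ := ⇑(cdf (gaussianReal 0 (σ ^ 2).toNNReal)) with hΦ
  set D : ℝ := inner ℝ β (y - x) with hD
  set u : ℝ := s - inner ℝ β x with hu
  have hder : HasDerivAt (fun t : ℝ => Φ (u - t * D))
      (-(gaussianPDFReal 0 (σ ^ 2).toNNReal u * D)) 0 := by
    have h1 : HasDerivAt (fun t : ℝ => u - t * D) (-D) 0 := by
      simpa using ((hasDerivAt_id (0 : ℝ)).mul_const D).const_sub u
    have h2 : HasDerivAt Φ (gaussianPDFReal 0 (σ ^ 2).toNNReal u) (u - 0 * D) := by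
      simpa using hasDerivAt_gaussian_cdf hv u
    have := h2.comp (0 : ℝ) h1
    simpa [Function.comp_def] using this
  have hslope := hder.tendsto_slope_zero_right
  have hlim : Tendsto (fun t : ℝ => (1 - t) * (a / 2 * ‖y - x‖ ^ 2)
      - t⁻¹ • (Φ (u - (0 + t) * D) - Φ (u - 0 * D))) (𝓝[>] 0)
      (𝓝 ((1 - 0) * (a / 2 * ‖y - x‖ ^ 2)
        - -(gaussianPDFReal 0 (σ ^ 2).toNNReal u * D))) := by
    refine Tendsto.sub ?_ hslope
    exact ((continuous_const.sub continuous_id).mul continuous_const).continuousWithinAt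
  rw [sub_zero, one_mul, sub_neg_eq_add] at hlim
  refine le_of_tendsto hlim ?_
  filter_upwards [Ioo_mem_nhdsGT (zero_lt_one' ℝ)] with t ht
  have hmem : (1 - t) • x + t • y ∈ X :=
    hX hx.1 hy (by linarith [ht.2]) ht.1.le (by ring)
  have hopt := hx.2 _ hmem
  rw [expectedUtility_eq hβ, expectedUtility_eq hβ] at hopt
  have hconv := hc.2.2.1.2 (Set.mem_univ (x - θ.raw)) (Set.mem_univ (y - θ.raw))
    (by linarith [ht.2] : 0 ≤ 1 - t) ht.1.le (by ring)
  have e1 : (1 - t) • (x - θ.raw) + t • (y - θ.raw) = (1 - t) • x + t • y - θ.raw := by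
    module
  have e2 : s - inner ℝ β ((1 - t) • x + t • y) = u - t * D := by
    rw [hu, hD, inner_add_right, inner_smul_right, inner_smul_right, inner_sub_right]
    ring
  have e3 : ‖x - θ.raw - (y - θ.raw)‖ = ‖y - x‖ := by
    rw [sub_sub_sub_cancel_right, norm_sub_rev]
  rw [e1, e3] at hconv
  rw [e2] at hopt
  simp only [smul_eq_mul] at hconv ⊢
  rw [zero_add, zero_mul, sub_zero]
  have ht0 := ht.1
  refine le_of_mul_le_mul_left ?_ ht0
  rw [mul_sub, mul_inv_cancel_left₀ ht0.ne']
  change -θ.cost ((1 - t) • x + t • y - θ.raw) + (1 - Φ (u - t * D))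
    ≤ -θ.cost (x - θ.raw) + (1 - Φ u) at hopt
  linarith

/-- The score component of the best response is Lipschitz in the threshold: adding the variational
inequalities at two thresholds gives `a |Δx|² ≤ H (|Δs| + |βᵀΔx|) |βᵀΔx|`, where `H` bounds the
slope of the noise density. -/
lemma mul_abs_responseScore_sub_le (hX : Convex ℝ X) (hXc : IsCompact X) (hraw : θ.raw ∈ X)
    (hσ : σ ^ 2 ≠ 0) (hβ : ‖β‖ = 1) (hc : AdmissibleCost θ.cost a) (s s' : ℝ) :
    (a - pdfSlope (σ ^ 2)) * |responseScore X σ β θ s - responseScore X σ β θ s'|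
      ≤ pdfSlope (σ ^ 2) * |s - s'| := by
  have hv : (σ ^ 2).toNNReal ≠ 0 := by simpa using hσ
  have hx := isBestResponse_bestResponse (s := s) hXc hraw hσ hβ hc
  have hy := isBestResponse_bestResponse (s := s') hXc hraw hσ hβ hc
  unfold responseScore
  set x := bestResponse X σ β s θ
  set y := bestResponse X σ β s' θ
  have h1 := hx.le_cost_sub hX hσ hβ hc hy.1
  have h2 := hy.le_cost_sub hX hσ hβ hc hx.1
  have hlip := abs_gaussianPDFReal_sub_le hv (s' - inner ℝ β y) (s - inner ℝ β x)
  rw [Real.coe_toNNReal _ (sq_nonneg σ)] at hlip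
  have hH := pdfSlope_nonneg (sq_nonneg σ)
  set H := pdfSlope (σ ^ 2)
  rw [inner_sub_right] at h1 h2
  have hnorm : |inner ℝ β x - inner ℝ β y| ≤ ‖x - y‖ := by
    rw [← inner_sub_right]
    simpa [hβ] using abs_real_inner_le_norm β (x - y)
  rw [norm_sub_rev] at h1
  set p := gaussianPDFReal 0 (σ ^ 2).toNNReal (s - inner ℝ β x)
  set p' := gaussianPDFReal 0 (σ ^ 2).toNNReal (s' - inner ℝ β y)
  set D : ℝ := inner ℝ β x - inner ℝ β y with hD
  have hsum : a * ‖x - y‖ ^ 2 ≤ (p - p') * D := by rw [hD]; linarith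
  have hpp : |p' - p| ≤ H * (|s - s'| + |D|) := by
    refine hlip.trans (mul_le_mul_of_nonneg_left ?_ hH)
    rw [show s' - inner ℝ β y - (s - inner ℝ β x) = -(s - s') + D by rw [hD]; ring]
    exact (abs_add_le _ _).trans (by rw [abs_neg])
  have hprod : (p - p') * D ≤ H * (|s - s'| + |D|) * |D| := by
    calc (p - p') * D ≤ |(p - p') * D| := le_abs_self _
      _ = |p' - p| * |D| := by rw [abs_mul, abs_sub_comm]
      _ ≤ _ := mul_le_mul_of_nonneg_right hpp (abs_nonneg _)
  have hsq : a * |D| ^ 2 ≤ a * ‖x - y‖ ^ 2 :=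
    mul_le_mul_of_nonneg_left (pow_le_pow_left₀ (abs_nonneg _) hnorm 2) hc.2.1.le
  rcases (abs_nonneg D).eq_or_lt with h0 | h0
  · rw [← h0, mul_zero]; positivity
  · refine le_of_mul_le_mul_right ?_ h0
    nlinarith

/-- Gaming moves the score upwards from `βᵀZ`, by at most a multiple of the noise density at the
margin. -/
lemma responseScore_sub_raw_mem (hX : Convex ℝ X) (hXc : IsCompact X) (hraw : θ.raw ∈ X)
    (hσ : σ ^ 2 ≠ 0) (hβ : ‖β‖ = 1) (hc : AdmissibleCost θ.cost a) (s : ℝ) :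
    a / 2 * ‖bestResponse X σ β s θ - θ.raw‖ ^ 2
        ≤ gaussianPDFReal 0 (σ ^ 2).toNNReal (s - responseScore X σ β θ s)
          * (responseScore X σ β θ s - inner ℝ β θ.raw) ∧
      0 ≤ responseScore X σ β θ s - inner ℝ β θ.raw ∧
      responseScore X σ β θ s - inner ℝ β θ.raw
        ≤ 2 / a * gaussianPDFReal 0 (σ ^ 2).toNNReal (s - responseScore X σ β θ s) := by
  have hv : (σ ^ 2).toNNReal ≠ 0 := by simpa using hσ
  have hx := isBestResponse_bestResponse (s := s) hXc hraw hσ hβ hc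
  have h1 := hx.le_cost_sub hX hσ hβ hc hraw
  have hmin := hc.2.2.2 (bestResponse X σ β s θ - θ.raw)
  have ha := hc.2.1
  rw [sub_self, inner_sub_right, norm_sub_rev] at h1
  unfold responseScore
  set x := bestResponse X σ β s θ
  have hp := gaussianPDFReal_pos 0 _ (s - inner ℝ β x) hv
  set p := gaussianPDFReal 0 (σ ^ 2).toNNReal (s - inner ℝ β x)
  have key : a / 2 * ‖x - θ.raw‖ ^ 2 ≤ p * (inner ℝ β x - inner ℝ β θ.raw) := by linarith
  have hnorm : |inner ℝ β x - inner ℝ β θ.raw| ≤ ‖x - θ.raw‖ := by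
    rw [← inner_sub_right]
    simpa [hβ] using abs_real_inner_le_norm β (x - θ.raw)
  have hnn : 0 ≤ inner ℝ β x - inner ℝ β θ.raw := by
    by_contra hneg
    have : p * (inner ℝ β x - inner ℝ β θ.raw) < 0 := mul_neg_of_pos_of_neg hp (not_le.1 hneg)
    have : 0 ≤ a / 2 * ‖x - θ.raw‖ ^ 2 := by positivity
    linarith
  refine ⟨key, hnn, ?_⟩
  rw [abs_of_nonneg hnn] at hnorm
  rcases hnn.eq_or_lt with h0 | h0
  · rw [← h0]; positivity
  · have hsq : a / 2 * (inner ℝ β x - inner ℝ β θ.raw) ^ 2 ≤ a / 2 * ‖x - θ.raw‖ ^ 2 := by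
      gcongr
    have : a / 2 * (inner ℝ β x - inner ℝ β θ.raw) ≤ p := by
      refine le_of_mul_le_mul_right ?_ h0
      nlinarith
    calc inner ℝ β x - inner ℝ β θ.raw
        = 2 / a * (a / 2 * (inner ℝ β x - inner ℝ β θ.raw)) := by field_simp
      _ ≤ _ := by gcongr

/-- An interior best response games strictly: the marginal cost at the raw covariates vanishes,
whereas the marginal benefit of moving along `β` is positive. -/
lemma raw_lt_responseScore (hX : Convex ℝ X) (hXc : IsCompact X) (hraw : θ.raw ∈ X)
    (hσ : σ ^ 2 ≠ 0) (hβ : ‖β‖ = 1) (hc : AdmissibleCost θ.cost a)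
    (hint : bestResponse X σ β s θ ∈ interior X) :
    inner ℝ β θ.raw < responseScore X σ β θ s := by
  have hv : (σ ^ 2).toNNReal ≠ 0 := by simpa using hσ
  obtain ⟨h1, h2, -⟩ := responseScore_sub_raw_mem hX hXc hraw hσ hβ hc s
  rw [sub_nonneg] at h2
  refine lt_of_le_of_ne h2 fun heq => ?_
  have ha := hc.2.1
  rw [← heq, sub_self, mul_zero] at h1
  have hxZ : bestResponse X σ β s θ = θ.raw := by
    have : ‖bestResponse X σ β s θ - θ.raw‖ ^ 2 ≤ 0 := by
      by_contra hpos
      have : 0 < a / 2 * ‖bestResponse X σ β s θ - θ.raw‖ ^ 2 :=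
        mul_pos (by linarith) (not_le.1 hpos)
      linarith
    have := pow_eq_zero_iff two_ne_zero |>.1 (le_antisymm this (sq_nonneg _))
    exact sub_eq_zero.1 (norm_eq_zero.1 this)
  have hx := isBestResponse_bestResponse (s := s) hXc hraw hσ hβ hc
  rw [hxZ] at hx hint
  set p := gaussianPDFReal 0 (σ ^ 2).toNNReal (s - inner ℝ β θ.raw) with hp
  have hppos : 0 < p := gaussianPDFReal_pos 0 _ _ hv
  -- the cost along the ray `t ↦ tβ` has a critical point at `0`
  have hdiff : HasDerivAt (fun t : ℝ => θ.cost (t • β)) 0 0 := by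
    have hd : DifferentiableAt ℝ (fun t : ℝ => θ.cost (t • β)) 0 := by
      have := (hc.1.differentiable (by norm_num)).differentiableAt (x := (0 : ℝ) • β)
      exact this.comp (0 : ℝ) (by fun_prop)
    have hmin : IsLocalMin (fun t : ℝ => θ.cost (t • β)) 0 :=
      Eventually.of_forall fun t => by simpa using hc.2.2.2 (t • β)
    exact hd.hasDerivAt.congr_deriv hmin.deriv_eq_zero
  have hmem : ∀ᶠ t in 𝓝[>] (0 : ℝ), θ.raw + t • β ∈ X := by
    have hcont : Tendsto (fun t : ℝ => θ.raw + t • β) (𝓝 0) (𝓝 (θ.raw + (0 : ℝ) • β)) :=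
      (by fun_prop : Continuous fun t : ℝ => θ.raw + t • β).tendsto 0
    rw [zero_smul, add_zero] at hcont
    exact nhdsWithin_le_nhds (hcont (mem_interior_iff_mem_nhds.1 hint))
  have hle : p ≤ 0 := by
    refine ge_of_tendsto hdiff.tendsto_slope_zero_right ?_
    filter_upwards [hmem, self_mem_nhdsWithin] with t ht ht0
    have ht0' : (0 : ℝ) < t := ht0
    have hvar := hx.le_cost_sub hX hσ hβ hc ht
    rw [add_sub_cancel_left, sub_self, inner_smul_right, real_inner_self_eq_norm_sq, hβ,
      one_pow, mul_one, ← hp] at hvar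
    rw [zero_add, zero_smul, smul_eq_mul, le_inv_mul_iff₀ ht0']
    have : 0 ≤ a / 2 * ‖t • β‖ ^ 2 := by positivity
    linarith
  linarith

/-- Far thresholds are not worth gaming for: the score tends to its raw value. -/
lemma tendsto_responseScore_atTop (hX : Convex ℝ X) (hXc : IsCompact X) (hraw : θ.raw ∈ X)
    (hσ : σ ^ 2 ≠ 0) (hβ : ‖β‖ = 1) (hc : AdmissibleCost θ.cost a) {B : ℝ}
    (hB : ∀ s, |responseScore X σ β θ s| ≤ B) :
    Tendsto (responseScore X σ β θ) atTop (𝓝 (inner ℝ β θ.raw)) := by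
  have hv : (σ ^ 2).toNNReal ≠ 0 := by simpa using hσ
  have h1 : Tendsto (fun s => s - responseScore X σ β θ s) atTop atTop := by
    refine tendsto_atTop_mono (fun s => ?_) (tendsto_atTop_add_const_right _ (-B) tendsto_id)
    have := (abs_le.1 (hB s)).2
    simp only [id]
    linarith
  have h2 := ((tendsto_gaussianPDFReal_atTop hv).comp h1).const_mul (2 / a)
  rw [mul_zero] at h2
  rw [tendsto_iff_dist_tendsto_zero]
  refine squeeze_zero (fun _ => dist_nonneg) (fun s => ?_) h2
  obtain ⟨-, h3, h4⟩ := responseScore_sub_raw_mem hX hXc hraw hσ hβ hc s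
  rw [Real.dist_eq, abs_of_nonneg h3]
  exact h4

end BestResponse

/-! ### The mean-field operator -/

lemma lipschitzConst_nonneg (f : ℝ → ℝ) : 0 ≤ lipschitzConst f :=
  Real.sInf_nonneg fun _ hK => hK.1

lemma lipschitzConst_le {f : ℝ → ℝ} {L : ℝ} (hL : 0 ≤ L)
    (h : ∀ x y, |f x - f y| ≤ L * |x - y|) : lipschitzConst f ≤ L :=
  csInf_le ⟨0, fun _ hK => hK.1⟩ ⟨hL, h⟩

/-- The smallest Lipschitz constant of a Lipschitz function is attained. -/
lemma abs_sub_le_lipschitzConst_mul {f : ℝ → ℝ} {L : ℝ} (hL : 0 ≤ L)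
    (h : ∀ x y, |f x - f y| ≤ L * |x - y|) (x y : ℝ) :
    |f x - f y| ≤ lipschitzConst f * |x - y| := by
  rcases (abs_nonneg (x - y)).eq_or_lt with h0 | h0
  · simpa [← h0] using h x y
  · rw [← div_le_iff₀ h0]
    exact le_csInf ⟨L, hL, h⟩ fun K hK => (div_le_iff₀ h0).2 (hK.2 x y)

instance {d : ℕ} : MeasurableSingletonClass (AgentType d) := ⟨fun _ => trivial⟩

instance {d : ℕ} (F : PMF (AgentType d)) (σ : ℝ) : IsProbabilityMeasure (agentLaw F σ) := by
  unfold agentLaw; infer_instance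

lemma score_eq {d : ℕ} (X : Set (Cov d)) (σ : ℝ) (β : Cov d) (s : ℝ) (b : Agent d) :
    score X σ β s b = responseScore X σ β b.1 s + inner ℝ β b.2 := inner_add_right _ _ _

lemma measurable_score {d : ℕ} (X : Set (Cov d)) (σ : ℝ) (β : Cov d) (s : ℝ) :
    Measurable (score X σ β s) := by
  have h1 : Measurable fun θ : AgentType d => responseScore X σ β θ s := measurable_from_top
  have h2 : Measurable fun b : Agent d => responseScore X σ β b.1 s + inner ℝ β b.2 :=
    (h1.comp measurable_fst).add (by fun_prop)
  rwa [show score X σ β s = _ from funext fun b => score_eq X σ β s b]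

/-- The standing assumptions on the covariate set, the type distribution, the noise level and the
selection criterion. -/
structure Assumptions {d : ℕ} (X : Set (Cov d)) (F : PMF (AgentType d)) (σ : ℝ) (β : Cov d)
    (α : AgentType d → ℝ) : Prop where
  convex : Convex ℝ X
  compact : IsCompact X
  raw_mem : ∀ θ ∈ F.support, θ.raw ∈ X
  norm_eq_one : ‖β‖ = 1
  cost : ∀ θ ∈ F.support, AdmissibleCost θ.cost (α θ)
  finite : F.support.Finite
  interior : ∀ θ ∈ F.support, ∀ s : ℝ, bestResponse X σ β s θ ∈ interior X
  noise : 2 / (alphaStar F α * √(2 * Real.pi * Real.exp 1)) < σ ^ 2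

namespace Assumptions

variable {d : ℕ} {X : Set (Cov d)} {F : PMF (AgentType d)} {σ q : ℝ} {β : Cov d}
  {α : AgentType d → ℝ} (R : Assumptions X F σ β α)

include R

lemma alphaStar_le {θ : AgentType d} (hθ : θ ∈ F.support) : alphaStar F α ≤ α θ := by
  have := R.finite.to_subtype
  exact ciInf_le (Set.finite_range fun θ : F.support => α θ).bddBelow ⟨θ, hθ⟩

lemma alphaStar_pos : 0 < alphaStar F α := by
  have := R.finite.to_subtype
  have := F.support_nonempty.to_subtype
  obtain ⟨θ, hθ⟩ := exists_eq_ciInf_of_finite (f := fun θ : F.support => α θ)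
  rw [alphaStar, ← hθ]
  exact (R.cost θ θ.2).2.1

lemma sq_pos : 0 < σ ^ 2 := by
  have := R.alphaStar_pos
  exact lt_trans (by positivity) R.noise

lemma pdfSlope_lt : pdfSlope (σ ^ 2) < alphaStar F α / 2 := by
  have h1 := R.alphaStar_pos
  have h2 := R.sq_pos
  have h3 := R.noise
  rw [div_lt_iff₀ (by positivity)] at h3
  rw [pdfSlope, div_lt_div_iff₀ (by positivity) two_pos]
  linarith

/-- Under the noise condition the responses of all types are contractions in the threshold. -/
lemma exists_contraction : ∃ L : ℝ, 0 ≤ L ∧ L < 1 ∧ ∀ θ ∈ F.support, ∀ s s' : ℝ,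
    |responseScore X σ β θ s - responseScore X σ β θ s'| ≤ L * |s - s'| := by
  have h1 := R.alphaStar_pos
  have h2 := R.pdfSlope_lt
  have hH := pdfSlope_nonneg R.sq_pos.le
  have h3 : 0 < alphaStar F α - pdfSlope (σ ^ 2) := by linarith
  refine ⟨pdfSlope (σ ^ 2) / (alphaStar F α - pdfSlope (σ ^ 2)), by positivity,
    (div_lt_one h3).2 (by linarith), fun θ hθ s s' => ?_⟩
  have h := mul_abs_responseScore_sub_le R.convex R.compact (R.raw_mem θ hθ) R.sq_pos.ne'
    R.norm_eq_one (R.cost θ hθ) s s'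
  rw [div_mul_eq_mul_div, le_div_iff₀ h3, mul_comm]
  refine le_trans (mul_le_mul_of_nonneg_right ?_ (abs_nonneg _)) h
  linarith [R.alphaStar_le hθ]

lemma exists_bound : ∃ B : ℝ, 0 ≤ B ∧ (∀ θ ∈ F.support, |inner ℝ β θ.raw| ≤ B) ∧
    ∀ θ ∈ F.support, ∀ s, |responseScore X σ β θ s| ≤ B := by
  obtain ⟨B, hB⟩ := R.compact.isBounded.exists_norm_le
  have h : ∀ x ∈ X, |inner ℝ β x| ≤ B := fun x hx => by
    have := abs_real_inner_le_norm β x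
    rw [R.norm_eq_one, one_mul] at this
    exact this.trans (hB x hx)
  obtain ⟨θ, hθ⟩ := F.support_nonempty
  exact ⟨B, (abs_nonneg _).trans (h _ (R.raw_mem θ hθ)), fun θ hθ => h _ (R.raw_mem θ hθ),
    fun θ hθ s => h _ (interior_subset (R.interior θ hθ s))⟩

lemma sum_weights : ∑ θ ∈ R.finite.toFinset, (F θ).toReal = 1 := by
  rw [← ENNReal.toReal_sum fun θ _ => F.apply_ne_top θ]
  have h : ∑' θ, F θ = ∑ θ ∈ R.finite.toFinset, F θ :=
    tsum_eq_sum fun θ hθ => by simpa using hθ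
  rw [← h, F.tsum_coe, ENNReal.toReal_one]

/-- The score distribution is the mixture over the types of the normal distributions
`N(βᵀx*(β, s), σ²)`. -/
lemma scoreCDF_eq (s r : ℝ) : scoreCDF X F σ β s r =
    mixture R.finite.toFinset (fun θ => (F θ).toReal) (cdf (gaussianReal 0 (σ ^ 2).toNNReal))
      (fun θ => responseScore X σ β θ s) r := by
  have hm := measurable_score X σ β s
  have hset : MeasurableSet {b : Agent d | score X σ β s b ≤ r} := measurableSet_le hm (by fun_prop)
  have : IsProbabilityMeasure ((agentLaw F σ).map (score X σ β s)) :=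
    Measure.isProbabilityMeasure_map hm.aemeasurable
  have hsec (θ : AgentType d) : (noiseLaw d σ (Prod.mk θ ⁻¹' {b | score X σ β s b ≤ r})).toReal
      = cdf (gaussianReal 0 (σ ^ 2).toNNReal) (r - responseScore X σ β θ s) := by
    rw [← noiseLaw_real_inner_le R.norm_eq_one, measureReal_def]
    congr 2
    ext ε
    simp [score_eq, le_sub_iff_add_le']
  rw [scoreCDF, cdf_eq_real, map_measureReal_apply hm measurableSet_Iic, measureReal_def]
  change (agentLaw F σ {b | score X σ β s b ≤ r}).toReal = _
  rw [agentLaw, Measure.prod_apply hset, ← integral_toReal, PMF.integral_eq_tsum, mixture,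
    tsum_eq_sum (s := R.finite.toFinset)]
  · refine Finset.sum_congr rfl fun θ _ => ?_
    rw [hsec, smul_eq_mul]
  · intro θ hθ
    have : F θ = 0 := by simpa using hθ
    simp [this]
  · refine Integrable.of_mem_Icc 0 1 (measurable_from_top.aemeasurable)
      (ae_of_all _ fun θ => ⟨ENNReal.toReal_nonneg, ?_⟩)
    exact measureReal_le_one
  · exact measurable_from_top.aemeasurable
  · exact ae_of_all _ fun θ => measure_lt_top _ _

lemma toNNReal_ne_zero : (σ ^ 2).toNNReal ≠ 0 := by
  have := R.sq_pos
  simpa using this.ne'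

lemma support_nonempty : R.finite.toFinset.Nonempty := by
  simp

lemma weights_pos : ∀ θ ∈ R.finite.toFinset, 0 < (F θ).toReal := fun θ hθ =>
  ENNReal.toReal_pos (by simpa using hθ) (F.apply_ne_top θ)

lemma strictMono_scoreCDF (s : ℝ) : StrictMono (scoreCDF X F σ β s) := by
  rw [show scoreCDF X F σ β s = _ from funext fun r => R.scoreCDF_eq s r]
  exact mixture_strictMono R.support_nonempty R.weights_pos
    (strictMono_gaussian_cdf R.toNNReal_ne_zero) _

/-- The mean-field quantiles are attained and uniformly bounded. -/
lemma exists_scoreCDF_meanFieldOp_eq (hq : q ∈ Set.Ioo (0 : ℝ) 1) :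
    ∃ K : ℝ, ∀ s, scoreCDF X F σ β s (meanFieldOp X F σ q β s) = q ∧
      |meanFieldOp X F σ q β s| ≤ K := by
  have hc := continuous_gaussian_cdf R.toNNReal_ne_zero
  obtain ⟨u, hu⟩ : ∃ u, cdf (gaussianReal 0 (σ ^ 2).toNNReal) u = q := by
    obtain ⟨a, ha⟩ := ((tendsto_cdf_atBot (gaussianReal 0 (σ ^ 2).toNNReal)).eventually
      (gt_mem_nhds hq.1)).exists
    obtain ⟨b, hb⟩ := ((tendsto_cdf_atTop (gaussianReal 0 (σ ^ 2).toNNReal)).eventually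
      (lt_mem_nhds hq.2)).exists
    exact mem_range_of_exists_le_of_exists_ge hc ⟨a, ha.le⟩ ⟨b, hb.le⟩
  obtain ⟨B, hB, -, hB'⟩ := R.exists_bound
  refine ⟨|u| + B, fun s => ?_⟩
  obtain ⟨r, hr, hrq⟩ := exists_mixture_eq (g := fun θ => responseScore X σ β θ s) R.weights_pos
    R.sum_weights (monotone_cdf _) hc hu hB fun θ hθ => hB' θ (by simpa using hθ) s
  rw [← R.scoreCDF_eq] at hrq
  rw [show meanFieldOp X F σ q β s = r from
    quantile_eq_of_strictMono (R.strictMono_scoreCDF s) hrq]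
  refine ⟨hrq, abs_le.2 ⟨?_, ?_⟩⟩
  · linarith [hr.1, neg_abs_le u]
  · linarith [hr.2, le_abs_self u]

lemma scoreCDF_meanFieldOp (hq : q ∈ Set.Ioo (0 : ℝ) 1) (s : ℝ) :
    scoreCDF X F σ β s (meanFieldOp X F σ q β s) = q := by
  obtain ⟨K, hK⟩ := R.exists_scoreCDF_meanFieldOp_eq hq
  exact (hK s).1

/-- The mean-field operator inherits the contraction constant of the responses, since quantiles of
location mixtures move no further than the locations. -/
lemma exists_meanFieldOp_lipschitz (hq : q ∈ Set.Ioo (0 : ℝ) 1) : ∃ L : ℝ, 0 ≤ L ∧ L < 1 ∧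
    ∀ s s' : ℝ, |meanFieldOp X F σ q β s - meanFieldOp X F σ q β s'| ≤ L * |s - s'| := by
  obtain ⟨L, hL0, hL1, hL⟩ := R.exists_contraction
  have key (s s' : ℝ) : meanFieldOp X F σ q β s ≤ meanFieldOp X F σ q β s' + L * |s - s'| := by
    have h1 := R.scoreCDF_meanFieldOp hq s
    have h2 := R.scoreCDF_meanFieldOp hq s'
    rw [R.scoreCDF_eq] at h1 h2
    refine le_add_of_mixture_eq R.support_nonempty R.weights_pos
      (strictMono_gaussian_cdf R.toNNReal_ne_zero) h1 h2 fun θ hθ => ?_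
    have := (abs_le.1 (hL θ (by simpa using hθ) s s')).2
    linarith
  refine ⟨L, hL0, hL1, fun s s' => abs_sub_le_iff.2 ⟨?_, ?_⟩⟩
  · linarith [key s s']
  · have := key s' s
    rw [abs_sub_comm s' s] at this
    linarith

/-- The mean-field operator is not constant. At every threshold the scores of all types exceed their
raw values, whereas they return to the raw values as the threshold grows; so a common `q`-quantile
would also be the `q`-quantile of the strictly smaller raw scores. -/
lemma meanFieldOp_not_const (hq : q ∈ Set.Ioo (0 : ℝ) 1) :
    ∃ s, meanFieldOp X F σ q β s ≠ meanFieldOp X F σ q β 0 := by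
  by_contra! hconst
  obtain ⟨B, -, -, hB⟩ := R.exists_bound
  set Φ : ℝ → ℝ := ⇑(cdf (gaussianReal 0 (σ ^ 2).toNNReal))
  have hΦ : Continuous Φ := continuous_gaussian_cdf R.toNNReal_ne_zero
  set m := meanFieldOp X F σ q β 0
  have hs (s : ℝ) : mixture R.finite.toFinset (fun θ => (F θ).toReal) Φ
      (fun θ => responseScore X σ β θ s) m = q := by
    have := R.scoreCDF_meanFieldOp hq s
    rwa [R.scoreCDF_eq, hconst] at this
  have hlim : Tendsto (fun s => mixture R.finite.toFinset (fun θ => (F θ).toReal) Φ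
      (fun θ => responseScore X σ β θ s) m) atTop
      (𝓝 (mixture R.finite.toFinset (fun θ => (F θ).toReal) Φ (fun θ => inner ℝ β θ.raw) m)) := by
    refine tendsto_finsetSum _ fun θ hθ => Tendsto.const_mul _ ?_
    have hθ' : θ ∈ F.support := by simpa using hθ
    exact (hΦ.tendsto _).comp ((tendsto_responseScore_atTop R.convex R.compact (R.raw_mem θ hθ')
      R.sq_pos.ne' R.norm_eq_one (R.cost θ hθ') (hB θ hθ')).const_sub m)
  have hraw : mixture R.finite.toFinset (fun θ => (F θ).toReal) Φ (fun θ => inner ℝ β θ.raw) m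
      = q := tendsto_nhds_unique hlim (by simp only [hs]; exact tendsto_const_nhds)
  have hlt : mixture R.finite.toFinset (fun θ => (F θ).toReal) Φ
      (fun θ => responseScore X σ β θ 0) m < mixture R.finite.toFinset (fun θ => (F θ).toReal) Φ
      (fun θ => inner ℝ β θ.raw) m := by
    refine mixture_lt_of_lt R.support_nonempty R.weights_pos
      (strictMono_gaussian_cdf R.toNNReal_ne_zero) fun θ hθ => ?_
    have hθ' : θ ∈ F.support := by simpa using hθ
    have := raw_lt_responseScore R.convex R.compact (R.raw_mem θ hθ')
      R.sq_pos.ne' R.norm_eq_one (R.cost θ hθ') (R.interior θ hθ' 0)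
    linarith
  rw [hs, hraw] at hlt
  exact lt_irrefl q hlt

lemma abs_meanFieldOp_sub_le (hq : q ∈ Set.Ioo (0 : ℝ) 1) (s s' : ℝ) :
    |meanFieldOp X F σ q β s - meanFieldOp X F σ q β s'|
      ≤ lipschitzConst (meanFieldOp X F σ q β) * |s - s'| := by
  obtain ⟨L, hL0, -, hL⟩ := R.exists_meanFieldOp_lipschitz hq
  exact abs_sub_le_lipschitzConst_mul hL0 hL s s'

lemma lipschitzConst_lt_one (hq : q ∈ Set.Ioo (0 : ℝ) 1) :
    lipschitzConst (meanFieldOp X F σ q β) < 1 := by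
  obtain ⟨L, hL0, hL1, hL⟩ := R.exists_meanFieldOp_lipschitz hq
  exact (lipschitzConst_le hL0 hL).trans_lt hL1

lemma lipschitzConst_pos (hq : q ∈ Set.Ioo (0 : ℝ) 1) :
    0 < lipschitzConst (meanFieldOp X F σ q β) := by
  refine lt_of_le_of_ne (lipschitzConst_nonneg _) fun h0 => ?_
  obtain ⟨s, hs⟩ := R.meanFieldOp_not_const hq
  have := R.abs_meanFieldOp_sub_le hq s 0
  rw [← h0, zero_mul] at this
  exact hs (sub_eq_zero.1 (abs_eq_zero.1 (le_antisymm this (abs_nonneg _))))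

lemma exists_unique_fixedPoint (hq : q ∈ Set.Ioo (0 : ℝ) 1) :
    ∃ sEq, ∀ s, meanFieldOp X F σ q β s = s ↔ s = sEq := by
  have hlip : ContractingWith (lipschitzConst (meanFieldOp X F σ q β)).toNNReal
      (meanFieldOp X F σ q β) := by
    refine ⟨by simpa using R.lipschitzConst_lt_one hq, LipschitzWith.of_dist_le_mul fun s s' => ?_⟩
    rw [Real.coe_toNNReal _ (lipschitzConst_nonneg _), Real.dist_eq, Real.dist_eq]
    exact R.abs_meanFieldOp_sub_le hq s s'
  refine ⟨ContractingWith.fixedPoint _ hlip, fun s => ⟨fun hs => hlip.fixedPoint_unique hs, ?_⟩⟩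
  rintro rfl
  exact hlip.fixedPoint_isFixedPt

/-- The gap is uniformly positive because the quantiles stay within a bounded distance of the
locations of the mixture. -/
lemma quantileGap_pos_and_le (hq : q ∈ Set.Ioo (0 : ℝ) 1) {l : ℝ} (hl : 0 < l) :
    0 < quantileGap X F σ q β l ∧
      ∀ s, q + quantileGap X F σ q β l ≤ scoreCDF X F σ β s (meanFieldOp X F σ q β s + l) ∧
        scoreCDF X F σ β s (meanFieldOp X F σ q β s - l) ≤ q - quantileGap X F σ q β l := by
  obtain ⟨K, hK⟩ := R.exists_scoreCDF_meanFieldOp_eq (q := q) hq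
  obtain ⟨B, -, -, hB⟩ := R.exists_bound
  obtain ⟨η, hη, hinc⟩ := exists_pos_le_increment
    (strictMono_gaussian_cdf R.toNNReal_ne_zero) (continuous_gaussian_cdf R.toNNReal_ne_zero) hl
    (K + B + l)
  have hlow (s : ℝ) : η ≤ min (scoreCDF X F σ β s (meanFieldOp X F σ q β s + l) - q)
      (q - scoreCDF X F σ β s (meanFieldOp X F σ q β s - l)) := by
    obtain ⟨hK1, hK2⟩ := abs_le.1 (hK s).2
    refine le_min ?_ ?_
    · nth_rewrite 2 [← (hK s).1]
      rw [R.scoreCDF_eq, R.scoreCDF_eq]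
      refine le_mixture_add_sub R.weights_pos R.sum_weights fun θ hθ => hinc _ ⟨?_, ?_⟩ <;>
      · obtain ⟨hB1, hB2⟩ := abs_le.1 (hB θ (by simpa using hθ) s)
        linarith
    · nth_rewrite 1 [← (hK s).1]
      rw [R.scoreCDF_eq, R.scoreCDF_eq]
      have := le_mixture_add_sub (Φ := cdf (gaussianReal 0 (σ ^ 2).toNNReal)) (l := l) (η := η)
        (r := meanFieldOp X F σ q β s - l) (g := fun θ => responseScore X σ β θ s)
        R.weights_pos R.sum_weights fun θ hθ => hinc _ (by
          obtain ⟨hB1, hB2⟩ := abs_le.1 (hB θ (by simpa using hθ) s)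
          constructor <;> linarith)
      rwa [sub_add_cancel] at this
  refine ⟨hη.trans_le (le_ciInf hlow), fun s => ?_⟩
  have hle : quantileGap X F σ q β l ≤ _ := ciInf_le ⟨η, Set.forall_mem_range.2 hlow⟩ s
  have h1 := hle.trans (min_le_left _ _)
  have h2 := hle.trans (min_le_right _ _)
  constructor <;> linarith

end Assumptions

/-! ### Empirical quantiles -/

lemma empiricalCDF_eq_sum {n : ℕ} (y : Fin n → ℝ) (r : ℝ) :
    empiricalCDF y r = (∑ i, if y i ≤ r then (1 : ℝ) else 0) / n := by
  rw [empiricalCDF, Finset.sum_boole]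

lemma monotone_empiricalCDF {n : ℕ} (y : Fin n → ℝ) : Monotone (empiricalCDF y) := by
  intro r r' h
  unfold empiricalCDF
  gcongr

lemma nonempty_le_empiricalCDF {n : ℕ} (hn : n ≠ 0) {q : ℝ} (hq : q ≤ 1) (y : Fin n → ℝ) :
    {r | q ≤ empiricalCDF y r}.Nonempty := by
  refine ⟨∑ i, |y i|, ?_⟩
  have h (i : Fin n) : y i ≤ ∑ j, |y j| :=
    (le_abs_self _).trans (Finset.single_le_sum (f := fun j => |y j|)
      (fun j _ => abs_nonneg _) (Finset.mem_univ i))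
  have hn' : (n : ℝ) ≠ 0 := by exact_mod_cast hn
  simpa [empiricalCDF_eq_sum, h, hn'] using hq

lemma bddBelow_le_empiricalCDF {n : ℕ} {q : ℝ} (hq : 0 < q) (y : Fin n → ℝ) :
    BddBelow {r | q ≤ empiricalCDF y r} := by
  refine ⟨-∑ i, |y i|, fun r hr => ?_⟩
  by_contra! hlt
  have h (i : Fin n) : ¬ y i ≤ r := by
    have := Finset.single_le_sum (f := fun j => |y j|) (fun j _ => abs_nonneg _)
      (Finset.mem_univ i)
    have := neg_abs_le (y i)
    linarith
  have h0 : empiricalCDF y r = 0 := by simp [empiricalCDF_eq_sum, h]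
  have hr' : q ≤ empiricalCDF y r := hr
  linarith

lemma measurable_empiricalCDF {n : ℕ} (r : ℝ) :
    Measurable fun y : Fin n → ℝ => empiricalCDF y r := by
  simp only [empiricalCDF_eq_sum]
  refine Measurable.div_const (Finset.measurable_sum _ fun i _ => ?_) _
  exact Measurable.ite (measurableSet_le (measurable_pi_apply i) measurable_const)
    measurable_const measurable_const

lemma measurable_quantile_empiricalCDF {n : ℕ} (hn : n ≠ 0) {q : ℝ} (hq : q ∈ Set.Ioo (0 : ℝ) 1) :
    Measurable fun y : Fin n → ℝ => quantile q (empiricalCDF y) := by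
  refine measurable_of_Iio fun r => ?_
  have h : (fun y : Fin n → ℝ => quantile q (empiricalCDF y)) ⁻¹' Set.Iio r
      = ⋃ p : {p : ℚ // (p : ℝ) < r}, {y | q ≤ empiricalCDF y (p.1 : ℝ)} := by
    ext y
    simp only [Set.mem_preimage, Set.mem_Iio, Set.mem_iUnion, Set.mem_ofPred_eq, Subtype.exists,
      exists_prop, quantile]
    rw [csInf_lt_iff (bddBelow_le_empiricalCDF hq.1 y) (nonempty_le_empiricalCDF hn hq.2.le y)]
    constructor
    · rintro ⟨a, ha, har⟩
      obtain ⟨p, hap, hpr⟩ := exists_rat_btwn har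
      exact ⟨p, hpr, le_trans ha (monotone_empiricalCDF y hap.le)⟩
    · rintro ⟨p, hpr, hp⟩
      exact ⟨p, hp, hpr⟩
  rw [h]
  exact MeasurableSet.iUnion fun p => measurableSet_le measurable_const (measurable_empiricalCDF _)

/-- An empirical quantile is far from `m` only if the empirical distribution function is far from
`q` at `m + l` or at `m - l`. -/
lemma empiricalCDF_of_lt_abs_quantile_sub {n : ℕ} (hn : n ≠ 0) {q : ℝ}
    (hq : q ∈ Set.Ioo (0 : ℝ) 1) {y : Fin n → ℝ} {m l : ℝ}
    (h : l < |quantile q (empiricalCDF y) - m|) :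
    empiricalCDF y (m + l) < q ∨ q ≤ empiricalCDF y (m - l) := by
  rcases lt_abs.1 h with h | h
  · refine Or.inl (not_le.1 fun hle => ?_)
    have : quantile q (empiricalCDF y) ≤ m + l :=
      csInf_le (bddBelow_le_empiricalCDF hq.1 y) hle
    linarith
  · right
    have hlt : quantile q (empiricalCDF y) < m - l := by linarith
    obtain ⟨a, ha, har⟩ := (csInf_lt_iff (bddBelow_le_empiricalCDF hq.1 y)
      (nonempty_le_empiricalCDF hn hq.2.le y)).1 hlt
    exact le_trans ha (monotone_empiricalCDF y har.le)

section Concentration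

variable {Ω : Type*} [MeasurableSpace Ω] {μ : Measure Ω} [IsProbabilityMeasure μ]

/-- Hoeffding's inequality for the mean of independent variables with values in `[0, 1]` and a
common mean, in both directions. -/
lemma measure_mean_sub_le {n : ℕ} (hn : n ≠ 0) {ξ : Fin n → Ω → ℝ} (hξ : ∀ i, Measurable (ξ i))
    (hb : ∀ i ω, ξ i ω ∈ Set.Icc (0 : ℝ) 1) (hind : iIndepFun ξ μ) {p : ℝ}
    (hp : ∀ i, ∫ ω, ξ i ω ∂μ = p) {M : ℝ} (hM : 0 ≤ M) :
    μ.real {ω | p + M ≤ (∑ i, ξ i ω) / n} ≤ Real.exp (-(2 * n * M ^ 2)) ∧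
      μ.real {ω | (∑ i, ξ i ω) / n ≤ p - M} ≤ Real.exp (-(2 * n * M ^ 2)) := by
  have hn' : (0 : ℝ) < n := by exact_mod_cast Nat.pos_of_ne_zero hn
  have hsub (i : Fin n) : HasSubgaussianMGF (fun ω => ξ i ω - p) ((1 / 2 : ℝ≥0) ^ 2) μ := by
    have := hasSubgaussianMGF_of_mem_Icc (hξ i).aemeasurable (ae_of_all μ (hb i))
    rw [hp i] at this
    simpa using this
  have hexp : -(n * M) ^ 2 / (2 * ((∑ _i : Fin n, (1 / 2 : ℝ≥0) ^ 2 : ℝ≥0) : ℝ))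
      = -(2 * n * M ^ 2) := by
    simp only [Finset.sum_const, Finset.card_univ, Fintype.card_fin, nsmul_eq_mul, NNReal.coe_mul,
      NNReal.coe_natCast, NNReal.coe_pow, NNReal.coe_div, NNReal.coe_one, NNReal.coe_ofNat]
    field_simp
  constructor
  · have h := HasSubgaussianMGF.measure_sum_ge_le_of_iIndepFun (s := Finset.univ)
      (hind.comp (fun _ x => x - p) fun _ => by fun_prop) (fun i _ => hsub i)
      (mul_nonneg hn'.le hM)
    rw [hexp] at h
    refine (measureReal_mono fun ω hω => ?_).trans h
    have hω' : p + M ≤ (∑ i, ξ i ω) / n := hω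
    rw [le_div_iff₀ hn'] at hω'
    simp only [Set.mem_ofPred_eq, Function.comp_apply, Finset.sum_sub_distrib, Finset.sum_const,
      Finset.card_univ, Fintype.card_fin, nsmul_eq_mul]
    linarith
  · have h := HasSubgaussianMGF.measure_sum_ge_le_of_iIndepFun (s := Finset.univ)
      (hind.comp (fun _ x => -(x - p)) fun _ => by fun_prop) (fun i _ => (hsub i).neg)
      (mul_nonneg hn'.le hM)
    rw [hexp] at h
    refine (measureReal_mono fun ω hω => ?_).trans h
    have hω' : (∑ i, ξ i ω) / n ≤ p - M := hω
    rw [div_le_iff₀ hn'] at hω'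
    simp only [Set.mem_ofPred_eq, Function.comp_apply, Finset.sum_neg_distrib,
      Finset.sum_sub_distrib, Finset.sum_const, Finset.card_univ, Fintype.card_fin, nsmul_eq_mul]
    linarith

/-- The empirical `q`-quantile of an i.i.d. sample concentrates around any point `m` across which
the distribution function `G` of the sample increases through `q` by a margin `M`. -/
lemma measure_quantile_empiricalCDF_le {n : ℕ} (hn : n ≠ 0) {q : ℝ} (hq : q ∈ Set.Ioo (0 : ℝ) 1)
    {Y : Fin n → Ω → ℝ} (hY : ∀ i, Measurable (Y i)) (hind : iIndepFun Y μ) {G : ℝ → ℝ}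
    (hG : ∀ i r, μ.real {ω | Y i ω ≤ r} = G r) {m l M : ℝ} (hM : 0 ≤ M)
    (h1 : q + M ≤ G (m + l)) (h2 : G (m - l) ≤ q - M) :
    μ.real {ω | l < |quantile q (empiricalCDF fun i => Y i ω) - m|}
      ≤ 2 * Real.exp (-(2 * n * M ^ 2)) := by
  have hφ (r : ℝ) : Measurable fun y : ℝ => if y ≤ r then (1 : ℝ) else 0 :=
    Measurable.ite measurableSet_Iic measurable_const measurable_const
  have key (r : ℝ) := measure_mean_sub_le (μ := μ) hn
    (ξ := fun i ω => if Y i ω ≤ r then (1 : ℝ) else 0)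
    (fun i => (hφ r).comp (hY i)) (fun i ω => by split_ifs <;> simp)
    (hind.comp (fun _ y => if y ≤ r then (1 : ℝ) else 0) fun _ => hφ r) (p := G r) (fun i => by
      have hset : MeasurableSet {ω | Y i ω ≤ r} := measurableSet_le (hY i) measurable_const
      rw [← hG i r, ← integral_indicator_one hset]
      rfl) hM
  simp only [← empiricalCDF_eq_sum] at key
  have hsub : {ω | l < |quantile q (empiricalCDF fun i => Y i ω) - m|} ⊆
      {ω | empiricalCDF (fun i => Y i ω) (m + l) ≤ G (m + l) - M} ∪
        {ω | G (m - l) + M ≤ empiricalCDF (fun i => Y i ω) (m - l)} := by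
    intro ω hω
    rcases empiricalCDF_of_lt_abs_quantile_sub hn hq hω with h | h
    · left; simp only [Set.mem_ofPred_eq]; linarith
    · right; simp only [Set.mem_ofPred_eq]; linarith
  calc μ.real {ω | l < |quantile q (empiricalCDF fun i => Y i ω) - m|}
      ≤ _ := measureReal_mono hsub
    _ ≤ _ := measureReal_union_le _ _
    _ ≤ Real.exp (-(2 * n * M ^ 2)) + Real.exp (-(2 * n * M ^ 2)) :=
        add_le_add (key (m + l)).2 (key (m - l)).1
    _ = _ := by ring

end Concentration

/-! ### The stochastic iteration -/

/-- The stochastic quantile iteration for a general score function `f`; `empThreshold` is the case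
`f = score X σ β`. -/
def thresholdSeq {A : Type*} {n : ℕ} (q : ℝ) (f : ℝ → A → ℝ) (s₀ : ℝ) (agents : ℕ → Fin n → A) :
    ℕ → ℝ
  | 0 => s₀
  | t + 1 => quantile q (empiricalCDF fun i => f (thresholdSeq q f s₀ agents t) (agents t i))

lemma measurable_thresholdSeq {A Ω : Type*} [MeasurableSpace A] [MeasurableSpace Ω] {n : ℕ}
    (hn : n ≠ 0) {q : ℝ} (hq : q ∈ Set.Ioo (0 : ℝ) 1) {f : ℝ → A → ℝ}
    (hf : Measurable (Function.uncurry f)) (s₀ : ℝ) {Y : ℕ → Fin n → Ω → A} (k : ℕ)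
    (hY : ∀ j < k, ∀ i, Measurable (Y j i)) :
    Measurable fun ω => thresholdSeq q f s₀ (fun j i => Y j i ω) k := by
  induction k with
  | zero => exact measurable_const
  | succ k ih =>
    have h1 := ih fun j hj => hY j (hj.trans k.lt_succ_self)
    exact (measurable_quantile_empiricalCDF hn hq).comp
      (measurable_pi_lambda _ fun i => hf.comp (h1.prodMk (hY k k.lt_succ_self i)))

section Step

variable {Ω A : Type*} [MeasurableSpace Ω] [MeasurableSpace A] {μ : Measure Ω}

/-- A threshold is a function of the agents of the earlier steps, hence independent of the agents
who respond to it. -/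
lemma indepFun_thresholdSeq {n : ℕ} (hn : n ≠ 0) {q : ℝ} (hq : q ∈ Set.Ioo (0 : ℝ) 1)
    {f : ℝ → A → ℝ} (hf : Measurable (Function.uncurry f)) (s₀ : ℝ) {Y : ℕ → Fin n → Ω → A}
    (hY : ∀ j i, Measurable (Y j i)) (hind : iIndepFun (fun p : ℕ × Fin n => Y p.1 p.2) μ)
    (k : ℕ) :
    IndepFun (fun ω => thresholdSeq q f s₀ (fun j i => Y j i ω) k) (fun ω i => Y k i ω) μ := by
  have h := indep_iSup_of_disjoint (S := {p : ℕ × Fin n | p.1 < k}) (T := {p | p.1 = k})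
    (fun p => (hY p.1 p.2).comap_le) hind.iIndep
    (Set.disjoint_left.2 fun p (hp : p.1 < k) hp' => hp.ne hp')
  refine (IndepFun_iff_Indep _ _ _).2 (indep_of_indep_of_le_left
    (indep_of_indep_of_le_right h (Measurable.comap_le ?_)) (Measurable.comap_le ?_))
  · refine @measurable_pi_lambda Ω (Fin n) (fun _ => A) (_) _ _ fun i => ?_
    rw [measurable_iff_comap_le]
    exact le_iSup₂_of_le (k, i) rfl le_rfl
  · refine @measurable_thresholdSeq A Ω _ (_) n hn q hq f hf s₀ Y k fun j hj i => ?_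
    rw [measurable_iff_comap_le]
    exact le_iSup₂_of_le (j, i) hj le_rfl

/-- One step of the iteration follows the deterministic operator `m` up to an error `l`, with high
probability. Independence allows conditioning on the current threshold. -/
lemma measure_thresholdSeq_succ_le [IsProbabilityMeasure μ] {n : ℕ} (hn : n ≠ 0) {q : ℝ}
    (hq : q ∈ Set.Ioo (0 : ℝ) 1) {f : ℝ → A → ℝ} (hf : Measurable (Function.uncurry f)) (s₀ : ℝ)
    {Y : ℕ → Fin n → Ω → A} (hY : ∀ j i, Measurable (Y j i))
    (hind : iIndepFun (fun p : ℕ × Fin n => Y p.1 p.2) μ)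
    {G : ℝ → ℝ → ℝ} (hG : ∀ j i s r, μ.real {ω | f s (Y j i ω) ≤ r} = G s r)
    {m : ℝ → ℝ} (hm : Measurable m) {l M : ℝ} (hM : 0 ≤ M)
    (hgap : ∀ s, q + M ≤ G s (m s + l) ∧ G s (m s - l) ≤ q - M) (k : ℕ) :
    μ {ω | l < |thresholdSeq q f s₀ (fun j i => Y j i ω) (k + 1)
        - m (thresholdSeq q f s₀ (fun j i => Y j i ω) k)|}
      ≤ ENNReal.ofReal (2 * Real.exp (-(2 * n * M ^ 2))) := by
  have hS : Measurable fun ω => thresholdSeq q f s₀ (fun j i => Y j i ω) k :=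
    measurable_thresholdSeq hn hq hf s₀ k fun j _ => hY j
  have hYk : Measurable fun ω => fun i => Y k i ω := measurable_pi_lambda _ (hY k)
  set B : Set (ℝ × (Fin n → A)) :=
    {z | l < |quantile q (empiricalCDF fun i => f z.1 (z.2 i)) - m z.1|} with hB
  have hBm : MeasurableSet B := by
    have h1 : Measurable fun z : ℝ × (Fin n → A) =>
        quantile q (empiricalCDF fun i => f z.1 (z.2 i)) :=
      (measurable_quantile_empiricalCDF hn hq).comp (measurable_pi_lambda _ fun i =>
        hf.comp (measurable_fst.prodMk ((measurable_pi_apply i).comp measurable_snd)))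
    exact measurableSet_lt measurable_const
      (measurable_abs.comp (h1.sub (hm.comp measurable_fst)))
  have hlaw := (indepFun_iff_map_prod_eq_prod_map_map hS.aemeasurable hYk.aemeasurable).1
    (indepFun_thresholdSeq hn hq hf s₀ hY hind k)
  have : IsProbabilityMeasure (μ.map fun ω => thresholdSeq q f s₀ (fun j i => Y j i ω) k) :=
    Measure.isProbabilityMeasure_map hS.aemeasurable
  have : IsProbabilityMeasure (μ.map fun ω => fun i => Y k i ω) :=
    Measure.isProbabilityMeasure_map hYk.aemeasurable
  have hsec (s : ℝ) : (μ.map fun ω => fun i => Y k i ω) (Prod.mk s ⁻¹' B)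
      ≤ ENNReal.ofReal (2 * Real.exp (-(2 * n * M ^ 2))) := by
    rw [Measure.map_apply hYk (measurable_prodMk_left hBm)]
    have hfs : Measurable (f s) := hf.comp measurable_prodMk_left
    have hinj : Function.Injective fun i : Fin n => (k, i) := fun i j h => by simpa using h
    have := measure_quantile_empiricalCDF_le (μ := μ) hn hq (Y := fun i ω => f s (Y k i ω))
      (fun i => hfs.comp (hY k i)) ((hind.precomp hinj).comp (fun _ => f s) fun _ => hfs)
      (fun i r => hG k i s r) hM (hgap s).1 (hgap s).2
    rw [← ofReal_measureReal]
    exact ENNReal.ofReal_le_ofReal this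
  calc _ = μ.map (fun ω => (thresholdSeq q f s₀ (fun j i => Y j i ω) k, fun i => Y k i ω)) B := by
        rw [Measure.map_apply (hS.prodMk hYk) hBm]
        rfl
    _ = ∫⁻ s, (μ.map fun ω => fun i => Y k i ω) (Prod.mk s ⁻¹' B)
          ∂(μ.map fun ω => thresholdSeq q f s₀ (fun j i => Y j i ω) k) := by
        rw [hlaw, Measure.prod_apply hBm]
    _ ≤ ∫⁻ _, ENNReal.ofReal (2 * Real.exp (-(2 * n * M ^ 2)))
          ∂(μ.map fun ω => thresholdSeq q f s₀ (fun j i => Y j i ω) k) := lintegral_mono hsec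
    _ = _ := by simp

end Step

/-- A perturbed contraction stays within the geometrically decaying initial error and the
accumulated perturbation. -/
lemma abs_sub_fixedPoint_le {m : ℝ → ℝ} {κ l x₀ : ℝ} (hκ0 : 0 ≤ κ) (hκ1 : κ < 1)
    (hm : ∀ s s', |m s - m s'| ≤ κ * |s - s'|) (hx₀ : m x₀ = x₀) {S : ℕ → ℝ} {t : ℕ}
    (hS : ∀ k < t, |S (k + 1) - m (S k)| ≤ l) :
    |S t - x₀| ≤ κ ^ t * |S 0 - x₀| + l / (1 - κ) * (1 - κ ^ t) := by
  induction t with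
  | zero => simp
  | succ t ih =>
    have h1 := ih fun k hk => hS k (hk.trans t.lt_succ_self)
    have h2 := hS t t.lt_succ_self
    have h3 := hm (S t) x₀
    rw [hx₀] at h3
    have h4 : |S (t + 1) - x₀| ≤ |S (t + 1) - m (S t)| + |m (S t) - x₀| := abs_sub_le _ _ _
    have h5 := mul_le_mul_of_nonneg_left h1 hκ0
    have h6 : 1 - κ ≠ 0 := by linarith
    calc |S (t + 1) - x₀| ≤ l + κ * (κ ^ t * |S 0 - x₀| + l / (1 - κ) * (1 - κ ^ t)) := by
          linarith
      _ = κ ^ (t + 1) * |S 0 - x₀| + l / (1 - κ) * (1 - κ ^ (t + 1)) := by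
          field_simp
          ring

/-- After `t ≥ ⌈log (λ / 2C) / log κ⌉` steps the initial error `C` has contracted to `λ / 2`; this
includes `C = 0`. -/
lemma pow_mul_le_half {κ C lam : ℝ} (hκ0 : 0 < κ) (hκ1 : κ < 1) (hC : 0 ≤ C) (hlam : 0 < lam)
    {t : ℕ} (ht : ⌈Real.log (lam / (2 * C)) / Real.log κ⌉ ≤ (t : ℤ)) :
    κ ^ t * C ≤ lam / 2 := by
  rcases hC.eq_or_lt with rfl | hC
  · rw [mul_zero]; linarith
  have h := Int.ceil_le.1 ht
  rw [div_le_iff_of_neg (Real.log_neg hκ0 hκ1)] at h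
  have h' : Real.log (κ ^ t) ≤ Real.log (lam / (2 * C)) := by
    rw [Real.log_pow]
    exact_mod_cast h
  rw [Real.log_le_log_iff (by positivity) (by positivity), le_div_iff₀ (by positivity)] at h'
  linarith

/-- The sample size makes the total failure probability of `t` steps at most `δ`. -/
lemma mul_two_mul_exp_le {M δ : ℝ} (hM : 0 < M) (hδ : 0 < δ) {t n : ℕ} (ht : t ≠ 0)
    (hn : 1 / (2 * M ^ 2) * Real.log (4 * t / δ) ≤ n) :
    t * (2 * Real.exp (-(2 * n * M ^ 2))) ≤ δ := by
  have ht' : (0 : ℝ) < t := by exact_mod_cast Nat.pos_of_ne_zero ht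
  rw [one_div, inv_mul_le_iff₀ (by positivity), Real.log_le_iff_le_exp (by positivity),
    div_le_iff₀ hδ] at hn
  rw [Real.exp_neg, show 2 * (n : ℝ) * M ^ 2 = 2 * M ^ 2 * n by ring, ← div_eq_mul_inv,
    mul_div_assoc', div_le_iff₀ (Real.exp_pos _)]
  linarith

/-- The score function with the types outside the finite set `T` removed. Unlike `score`, whose
dependence on the threshold is arbitrary for types without regularity, it is jointly measurable. -/
def finiteScore {d : ℕ} (X : Set (Cov d)) (σ : ℝ) (β : Cov d) (T : Finset (AgentType d)) (s : ℝ)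
    (b : Agent d) : ℝ :=
  (∑ θ ∈ T, ({θ} : Set (AgentType d)).indicator (fun _ => responseScore X σ β θ s) b.1)
    + inner ℝ β b.2

lemma finiteScore_eq_score {d : ℕ} {X : Set (Cov d)} {σ : ℝ} {β : Cov d}
    {T : Finset (AgentType d)} {b : Agent d} (hb : b.1 ∈ T) (s : ℝ) :
    finiteScore X σ β T s b = score X σ β s b := by
  rw [finiteScore, score_eq, Finset.sum_eq_single_of_mem b.1 hb]
  · simp
  · intro θ _ hθ
    simp [Ne.symm hθ]

lemma measurable_finiteScore {d : ℕ} {X : Set (Cov d)} {σ : ℝ} {β : Cov d}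
    {T : Finset (AgentType d)} (hT : ∀ θ ∈ T, Measurable (responseScore X σ β θ)) :
    Measurable (Function.uncurry (finiteScore X σ β T)) := by
  refine Measurable.add (Finset.measurable_sum _ fun θ hθ => ?_) (by fun_prop)
  have h : (fun z : ℝ × Agent d =>
      ({θ} : Set (AgentType d)).indicator (fun _ => responseScore X σ β θ z.1) z.2.1)
      = ((fun z : ℝ × Agent d => z.2.1) ⁻¹' {θ}).indicator
        fun z => responseScore X σ β θ z.1 := by
    funext z
    rfl
  rw [h]
  exact ((hT θ hθ).comp measurable_fst).indicator
    ((measurable_fst.comp measurable_snd) (measurableSet_singleton θ))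

lemma thresholdSeq_eq_empThreshold {d n : ℕ} {X : Set (Cov d)} {σ q : ℝ} {β : Cov d}
    {T : Finset (AgentType d)} (s₀ : ℝ) {agents : ℕ → Fin n → Agent d}
    (h : ∀ k i, (agents k i).1 ∈ T) (t : ℕ) :
    thresholdSeq q (finiteScore X σ β T) s₀ agents t = empThreshold X σ q β s₀ agents t := by
  induction t with
  | zero => rfl
  | succ t ih => simp only [thresholdSeq, empThreshold, ih, finiteScore_eq_score (h t _)]

lemma ae_agentLaw_mem_support {d : ℕ} (F : PMF (AgentType d)) (σ : ℝ) :
    ∀ᵐ b ∂(agentLaw F σ), b.1 ∈ F.support := by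
  refine Measure.quasiMeasurePreserving_fst.ae (p := fun θ => θ ∈ F.support) ?_
  exact (F.toMeasure_apply_eq_zero_iff trivial).2 disjoint_compl_right

namespace Assumptions

variable {d : ℕ} {X : Set (Cov d)} {F : PMF (AgentType d)} {σ q : ℝ} {β : Cov d}
  {α : AgentType d → ℝ} (R : Assumptions X F σ β α)

include R

lemma measurable_responseScore {θ : AgentType d} (hθ : θ ∈ F.support) :
    Measurable (responseScore X σ β θ) := by
  obtain ⟨L, hL0, -, hL⟩ := R.exists_contraction
  refine (LipschitzWith.of_dist_le_mul (K := L.toNNReal) fun s s' => ?_).continuous.measurable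
  rw [Real.coe_toNNReal _ hL0]
  exact hL θ hθ s s'

lemma measurable_meanFieldOp (hq : q ∈ Set.Ioo (0 : ℝ) 1) :
    Measurable (meanFieldOp X F σ q β) := by
  refine (LipschitzWith.of_dist_le_mul (K := (lipschitzConst (meanFieldOp X F σ q β)).toNNReal)
    fun s s' => ?_).continuous.measurable
  rw [Real.coe_toNNReal _ (lipschitzConst_nonneg _)]
  exact R.abs_meanFieldOp_sub_le hq s s'

/-- With high probability each of the first `t` steps of the stochastic iteration follows the
mean-field operator up to an error `l`. -/
lemma measure_exists_step_error_le (hq : q ∈ Set.Ioo (0 : ℝ) 1) {l : ℝ} (hl : 0 < l)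
    {Ω : Type*} [MeasurableSpace Ω] {μ : Measure Ω} [IsProbabilityMeasure μ] {n : ℕ} (hn : n ≠ 0)
    {A : ℕ → Fin n → Ω → Agent d} (hA : ∀ t i, HasLaw (A t i) (agentLaw F σ) μ)
    (hind : iIndepFun (fun p : ℕ × Fin n => A p.1 p.2) μ) (s₀ : ℝ) (t : ℕ) :
    μ {ω | ∃ k < t, l < |empThreshold X σ q β s₀ (fun k i => A k i ω) (k + 1)
        - meanFieldOp X F σ q β (empThreshold X σ q β s₀ (fun k i => A k i ω) k)|}
      ≤ ENNReal.ofReal (t * (2 * Real.exp (-(2 * n * quantileGap X F σ q β l ^ 2)))) := by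
  obtain ⟨hgap0, hgap⟩ := R.quantileGap_pos_and_le hq hl
  -- Replace the agents by everywhere measurable versions, and `score` by `finiteScore`.
  set Y : ℕ → Fin n → Ω → Agent d := fun k i => (hA k i).aemeasurable.mk (A k i)
  have hY (k : ℕ) (i : Fin n) : Measurable (Y k i) := (hA k i).aemeasurable.measurable_mk
  have hAY (k : ℕ) (i : Fin n) : A k i =ᵐ[μ] Y k i := (hA k i).aemeasurable.ae_eq_mk
  have hlaw (k : ℕ) (i : Fin n) : μ.map (Y k i) = agentLaw F σ := by
    rw [← Measure.map_congr (hAY k i), (hA k i).map_eq]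
  have hindY : iIndepFun (fun p : ℕ × Fin n => Y p.1 p.2) μ :=
    hind.congr fun p => hAY p.1 p.2
  set f := finiteScore X σ β R.finite.toFinset
  have hf : Measurable (Function.uncurry f) :=
    measurable_finiteScore fun θ hθ => R.measurable_responseScore (by simpa using hθ)
  have hsupp (k : ℕ) (i : Fin n) : ∀ᵐ ω ∂μ, (Y k i ω).1 ∈ R.finite.toFinset := by
    have := ae_agentLaw_mem_support F σ
    rw [← hlaw k i] at this
    filter_upwards [ae_of_ae_map (hY k i).aemeasurable this] with ω hω
    simpa using hω
  have hG (k : ℕ) (i : Fin n) (s r : ℝ) :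
      μ.real {ω | f s (Y k i ω) ≤ r} = scoreCDF X F σ β s r := by
    have hm := measurable_score X σ β s
    have : IsProbabilityMeasure ((agentLaw F σ).map (score X σ β s)) :=
      Measure.isProbabilityMeasure_map hm.aemeasurable
    rw [scoreCDF, cdf_eq_real, map_measureReal_apply hm measurableSet_Iic, ← hlaw k i,
      map_measureReal_apply (hY k i) (hm measurableSet_Iic)]
    refine measureReal_congr ?_
    filter_upwards [hsupp k i] with ω hω
    exact congrArg (· ≤ r) (finiteScore_eq_score hω s)
  have hstep := measure_thresholdSeq_succ_le hn hq hf s₀ hY hindY hG (R.measurable_meanFieldOp hq)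
    hgap0.le hgap
  have hae : ∀ᵐ ω ∂μ, ∀ k, thresholdSeq q f s₀ (fun j i => Y j i ω) k
      = empThreshold X σ q β s₀ (fun j i => A j i ω) k := by
    filter_upwards [ae_all_iff.2 fun k => ae_all_iff.2 (hAY k),
      ae_all_iff.2 fun k => ae_all_iff.2 (hsupp k)] with ω h1 h2 k
    simp only [h1]
    exact thresholdSeq_eq_empThreshold s₀ h2 k
  calc _ ≤ μ (⋃ k ∈ Finset.range t, {ω | l < |thresholdSeq q f s₀ (fun j i => Y j i ω) (k + 1)
          - meanFieldOp X F σ q β (thresholdSeq q f s₀ (fun j i => Y j i ω) k)|}) := by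
        refine measure_mono_ae ?_
        filter_upwards [hae] with ω hω hbad
        obtain ⟨k, hk, hlt⟩ := hbad
        refine Set.mem_iUnion₂.2 ⟨k, Finset.mem_range.2 hk, ?_⟩
        simpa only [Set.mem_ofPred_eq, hω] using hlt
    _ ≤ ∑ k ∈ Finset.range t, _ := measure_biUnion_finset_le _ _
    _ ≤ ∑ _k ∈ Finset.range t,
          ENNReal.ofReal (2 * Real.exp (-(2 * n * quantileGap X F σ q β l ^ 2))) :=
        Finset.sum_le_sum fun k _ => hstep k
    _ = _ := by
        rw [Finset.sum_const, Finset.card_range, nsmul_eq_mul,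
          ENNReal.ofReal_mul (p := (t : ℝ)) (by positivity), ENNReal.ofReal_natCast]

end Assumptions

end StrategicThreshold

end

theorem theorem2 {d : ℕ}
    -- the covariate set, the type distribution, the noise level and the capacity
    (X : Set (StrategicThreshold.Cov d)) (hXconv : Convex ℝ X) (hXcomp : IsCompact X)
    (F : PMF (StrategicThreshold.AgentType d)) (σ q : ℝ) (hq : q ∈ Set.Ioo (0 : ℝ) 1)
    (hraw : ∀ θ ∈ F.support, θ.raw ∈ X)
    -- the selection criterion, a unit vector
    (β : StrategicThreshold.Cov d) (hβ : ‖β‖ = 1)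
    -- strongly convex costs, finitely many types, interior best responses
    (α : StrategicThreshold.AgentType d → ℝ)
    (hcost : ∀ θ ∈ F.support, StrategicThreshold.AdmissibleCost θ.cost (α θ))
    (hfin : F.support.Finite)
    (hint : ∀ θ ∈ F.support, ∀ s : ℝ,
      StrategicThreshold.bestResponse X σ β s θ ∈ interior X)
    -- the noise condition
    (hσ : 2 / (StrategicThreshold.alphaStar F α * √(2 * Real.pi * Real.exp 1)) < σ ^ 2)
    -- the probability space on which the agents are sampled
    {Ω : Type*} [MeasurableSpace Ω] (μ : Measure Ω) [IsProbabilityMeasure μ] :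
    ∃ sEq κ : ℝ,
      -- `sEq = s(β)` is the unique mean-field equilibrium threshold
      (∀ s : ℝ, StrategicThreshold.meanFieldOp X F σ q β s = s ↔ s = sEq) ∧
      -- `κ` is the Lipschitz constant of the mean-field operator, which is a contraction
      κ = StrategicThreshold.lipschitzConst (StrategicThreshold.meanFieldOp X F σ q β) ∧
      0 < κ ∧ κ < 1 ∧
      (∀ s s' : ℝ, |StrategicThreshold.meanFieldOp X F σ q β s
        - StrategicThreshold.meanFieldOp X F σ q β s'| ≤ κ * |s - s'|) ∧
      ∀ lam ∈ Set.Ioo (0 : ℝ) 1, ∀ δ ∈ Set.Ioo (0 : ℝ) 1,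
        0 < StrategicThreshold.quantileGap X F σ q β (lam * (1 - κ) / 2) ∧
        ∀ (n : ℕ) (A : ℕ → Fin n → Ω → StrategicThreshold.Agent d),
          (∀ t i, HasLaw (A t i) (StrategicThreshold.agentLaw F σ) μ) →
          iIndepFun (fun p : ℕ × Fin n => A p.1 p.2) μ →
          ∀ (s₀ : ℝ) (t : ℕ),
            ⌈Real.log (lam / (2 * |s₀ - sEq|)) / Real.log κ⌉ ≤ (t : ℤ) →
            1 / (2 * StrategicThreshold.quantileGap X F σ q β (lam * (1 - κ) / 2) ^ 2)
              * Real.log (4 * t / δ) ≤ (n : ℝ) →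
            μ {ω | lam ≤ |StrategicThreshold.empThreshold X σ q β s₀ (fun k i => A k i ω) t
              - sEq|} ≤ ENNReal.ofReal δ := by
  have R : StrategicThreshold.Assumptions X F σ β α :=
    ⟨hXconv, hXcomp, hraw, hβ, hcost, hfin, hint, hσ⟩
  obtain ⟨sEq, hsEq⟩ := R.exists_unique_fixedPoint hq
  have hκ0 := R.lipschitzConst_pos hq
  have hκ1 := R.lipschitzConst_lt_one hq
  have hlip := R.abs_meanFieldOp_sub_le hq
  set κ := StrategicThreshold.lipschitzConst (StrategicThreshold.meanFieldOp X F σ q β)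
  refine ⟨sEq, κ, hsEq, rfl, hκ0, hκ1, hlip, fun lam hlam δ hδ => ?_⟩
  have hl : 0 < lam * (1 - κ) / 2 := by
    have := mul_pos hlam.1 (sub_pos.2 hκ1)
    linarith
  have hM := (R.quantileGap_pos_and_le hq hl).1
  refine ⟨hM, fun n A hA hind s₀ t ht hn => ?_⟩
  have hinit : κ ^ t * |s₀ - sEq| ≤ lam / 2 :=
    StrategicThreshold.pow_mul_le_half hκ0 hκ1 (abs_nonneg _) hlam.1 ht
  have hpow : 0 < κ ^ t := pow_pos hκ0 t
  -- If no step errs by more than `λ (1 - κ) / 2`, the final error is at most `λ - κ ^ t λ / 2`.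
  have hsub : {ω | lam ≤ |StrategicThreshold.empThreshold X σ q β s₀ (fun k i => A k i ω) t - sEq|}
      ⊆ {ω | ∃ k < t, lam * (1 - κ) / 2
        < |StrategicThreshold.empThreshold X σ q β s₀ (fun k i => A k i ω) (k + 1)
          - StrategicThreshold.meanFieldOp X F σ q β
            (StrategicThreshold.empThreshold X σ q β s₀ (fun k i => A k i ω) k)|} := by
    intro ω hω
    by_contra hgood
    simp only [Set.mem_ofPred_eq, not_exists, not_and, not_lt] at hω hgood
    have h := StrategicThreshold.abs_sub_fixedPoint_le hκ0.le hκ1 hlip ((hsEq sEq).2 rfl) hgood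
    have h0 : StrategicThreshold.empThreshold X σ q β s₀ (fun k i => A k i ω) 0 = s₀ := rfl
    have hquot : lam * (1 - κ) / 2 / (1 - κ) = lam / 2 := by
      have : 1 - κ ≠ 0 := (sub_pos.2 hκ1).ne'
      field_simp
    rw [h0, hquot] at h
    have := mul_pos hlam.1 hpow
    linarith
  refine (measure_mono hsub).trans ?_
  rcases eq_or_ne t 0 with rfl | ht0
  · simp
  have hn0 : n ≠ 0 := by
    rintro rfl
    have h4 : (1 : ℝ) < 4 * t / δ := by
      have : (1 : ℝ) ≤ t := by exact_mod_cast Nat.one_le_iff_ne_zero.2 ht0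
      rw [lt_div_iff₀ hδ.1]
      linarith [hδ.2]
    have := Real.log_pos h4
    have : 0 < 1 / (2 * StrategicThreshold.quantileGap X F σ q β (lam * (1 - κ) / 2) ^ 2)
        * Real.log (4 * t / δ) := by positivity
    rw [Nat.cast_zero] at hn
    linarith
  exact (R.measure_exists_step_error_le hq hl hn0 hA hind s₀ t).trans
    (ENNReal.ofReal_le_ofReal (StrategicThreshold.mul_two_mul_exp_le hM hδ.1 ht0 hn))
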